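/- Let $O$ be the origin of $\mathbb R^3$, $S^2$ the unit sphere with surface measure $dx$, and $\Omega\subseteq S^2$ a set whose boundary in $S^2$ has surface measure $0$. Let $D\subset\mathbb R^3$ be compact with $O\notin D$, and suppose that $D$ is contained in a plane or that $D$ is countable; put $M=\max_{P\in D}|P|$. For $P\ne O$ and $d>0$ let $E_d(P)$ be the ellipsoid of revolution with foci $O,P$ and polar radius $$\rho_{d,P}(x)=\frac{d}{1-\varepsilon\,x\cdot m},\qquad m=\frac{P}{|P|},\quad \varepsilon=\sqrt{1+\frac{d^2}{|P|^2}}-\frac{d}{|P|},\quad x\in S^2 .$$ For a function $\rho$ on $\overline\Omega$ let $\sigma=\{\rho(x)x\}_{x\in\overline\Omega}$. We say that $E_d(P)$ supports $\sigma$ at $\rho(x_0)x_0$ if $\rho(x)\le\rho_{d,P}(x)$ for all $x\in\overline\Omega$, with equality at $x=x_0$. The surface $\sigma$ is a reflector from $\overline\Omega$ to $D$ if for every $x_0\in\overline\Omega$ some $E_d(P)$ with $P\in D$, $d>0$ supports $\sigma$ at $\rho(x_0)x_0$; for $\delta>0$ the class $\mathcal A(\delta)$ consists of the reflectors for which at every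 $x_0\in\overline\Omega$ such an ellipsoid exists with $d\ge\delta M$. For $E\subseteq D$ let $\tau_\sigma(E)$ be the set of $x\in\overline\Omega$ such that for some $P\in E$ and $d>0$ the ellipsoid $E_d(P)$ supports $\sigma$ at $\rho(x)x$. Let $\nu_\rho(x)$ be the outer unit normal to $\sigma$ at $\rho(x)x$. Let $f\in L^1(\overline\Omega)$ with $f>0$ a.e., and let $\eta$ be a Radon measure on $D$. Given $\delta>0$, put $c_\delta=-\delta+\sqrt{1+\delta^2}$, let $k\ge\frac{1+c_\delta}{1-c_\delta}$, and assume $$\int_{\overline\Omega}f(x)\,dx\ \ge\ \frac{1}{C(\delta,k\delta,M)}\,\eta(D),\qquad C(\delta,k\delta,M)=\frac{(1-c_\delta)^3}{(1+c_\delta)(k\delta M)^2}.$$ Let $P_0\in\operatorname{supp}\eta$. Then there is a reflector $\sigma=\{\rho(x)x\}_{x\in\overline\Omega}$ from $\overline\Omega$ to $D$ in $\mathcal A(\delta)$ such that the normal $\nu_\rho(x)$ exists for a.e. $x\in\overline\Omega$; for every Borel set $E\subseteq D$ the set $\tau_\sigma(E)$ is Lebesgue measurable, $f(x)\,\frac{x\cdot\nu_\rho(x)}{\rho(x)^2}$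 is integrable on it, and $$\eta(E)\le\int_{\tau_\sigma(E)}f(x)\,\frac{x\cdot\nu_\rho(x)}{\rho(x)^2}\,dx,$$ with equality for every Borel set $E\subseteq D$ with $P_0\notin E$; and $$\frac{\delta M}{1+c_\delta}\le\rho(x)\le\frac{k\delta M}{1-c_\delta}\qquad\text{for all }x\in\overline\Omega .$$ -/

import Mathlib

open MeasureTheory Metric Set

noncomputable section

namespace NearField

/-- Three-dimensional Euclidean space; the light source is the origin `O = 0`. -/
abbrev Space : Type := EuclideanSpace ℝ (Fin 3)

/-- The unit sphere of directions. -/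
abbrev Sph : Type := sphere (0 : Space) 1

/-- The surface measure of the unit sphere (total mass `4π`). -/
def surf : Measure Sph := (volume : Measure Space).toSphere

/-- `M = max_{P ∈ D} OP` (a maximum when `D` is compact and nonempty). -/
def maxDist (D : Set Space) : ℝ := sSup ((fun P : Space => ‖P‖) '' D)

/-- `D` lies in a plane `{X : n · X = c}`, `n ≠ 0`. -/
def InPlane (D : Set Space) : Prop :=
  ∃ n : Space, n ≠ 0 ∧ ∃ c : ℝ, ∀ P ∈ D, inner ℝ n P = c

/-- The eccentricity `ε = √(1 + d²/OP²) - d/OP` of the ellipsoid `E_d(P)`. -/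
def ecc (d : ℝ) (P : Space) : ℝ := √(1 + d ^ 2 / ‖P‖ ^ 2) - d / ‖P‖

/-- The polar radius `ρ_d(x) = d / (1 - ε x · m)`, `m = P / OP`, of the ellipsoid of revolution
`E_d(P)` with foci `O` and `P`. -/
def polarRadius (d : ℝ) (P : Space) (x : Sph) : ℝ :=
  d / (1 - ecc d P * inner ℝ (x : Space) (‖P‖⁻¹ • P))

/-- The ellipsoid `E_d(P)` supports the surface `σ = {ρ(x) x : x ∈ closure Ω}` at `ρ(x₀) x₀`. -/
def Supports (Ω : Set Sph) (ρ : Sph → ℝ) (d : ℝ) (P : Space) (x₀ : Sph) : Prop :=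
  0 < d ∧ (∀ x ∈ closure Ω, ρ x ≤ polarRadius d P x) ∧ ρ x₀ = polarRadius d P x₀

/-- `σ = {ρ(x) x : x ∈ closure Ω}` is a reflector from `closure Ω` to `D`. -/
def IsReflector (Ω : Set Sph) (D : Set Space) (ρ : Sph → ℝ) : Prop :=
  ∀ x₀ ∈ closure Ω, ∃ P ∈ D, ∃ d : ℝ, Supports Ω ρ d P x₀

/-- The class `𝒜(δ)` of reflectors having at each point a supporting ellipsoid `E_d(P)`
with `P ∈ D` and `d ≥ δ M`. -/
def IsInClassA (Ω : Set Sph) (D : Set Space) (δ : ℝ) (ρ : Sph → ℝ) : Prop :=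
  IsReflector Ω D ρ ∧
    ∀ x₀ ∈ closure Ω, ∃ P ∈ D, ∃ d : ℝ, δ * maxDist D ≤ d ∧ Supports Ω ρ d P x₀

/-- The reflector mapping `𝒩_σ(x₀)`. -/
def reflectorMap (Ω : Set Sph) (D : Set Space) (ρ : Sph → ℝ) (x₀ : Sph) : Set Space :=
  {P | P ∈ D ∧ ∃ d : ℝ, Supports Ω ρ d P x₀}

/-- The tracing mapping `τ_σ(E) = ⋃_{P ∈ E} τ_σ(P)`. -/
def trace (Ω : Set Sph) (D : Set Space) (ρ : Sph → ℝ) (E : Set Space) : Set Sph :=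
  {x | x ∈ closure Ω ∧ ∃ P ∈ E, P ∈ reflectorMap Ω D ρ x}

/-- The radial projection of a nonzero point to the unit sphere. -/
def direction (y : Space) (hy : y ≠ 0) : Sph :=
  ⟨‖y‖⁻¹ • y, by simp [norm_smul, hy]⟩

open Classical in
/-- The function `h(y) = |y| - ρ(y/|y|)`, which vanishes on the surface `{ρ(x) x}`, is negative
inside and positive outside (the value at `y = 0` is irrelevant). -/
def levelFn (ρ : Sph → ℝ) (y : Space) : ℝ :=
  if hy : y ≠ 0 then ‖y‖ - ρ (direction y hy) else 0

/-- The surface `{ρ(x) x}` has a tangent plane at `ρ(x) x`. -/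
def HasNormal (ρ : Sph → ℝ) (x : Sph) : Prop :=
  DifferentiableAt ℝ (levelFn ρ) (ρ x • (x : Space))

/-- The outer unit normal `ν(x) = ∇h / |∇h|` to the surface `{ρ(x) x}` at `ρ(x) x`. -/
def outerNormal (ρ : Sph → ℝ) (x : Sph) : Space :=
  ‖gradient (levelFn ρ) (ρ x • (x : Space))‖⁻¹ • gradient (levelFn ρ) (ρ x • (x : Space))

/-- The density `f(x) (x · ν(x)) / ρ(x)²`. -/
def irradiance (f ρ : Sph → ℝ) (x : Sph) : ℝ :=
  f x * (inner ℝ (x : Space) (outerNormal ρ x) / ρ x ^ 2)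

/-- `c_δ = -δ + √(1 + δ²)`. -/
def cConst (δ : ℝ) : ℝ := -δ + √(1 + δ ^ 2)

/-- `C(δ, δ', M) = (1 - c_δ)³ / ((1 + c_δ) (δ' M)²)`. -/
def energyConst (δ δ' M : ℝ) : ℝ :=
  (1 - cConst δ) ^ 3 / ((1 + cConst δ) * (δ' * M) ^ 2)

end NearField

end

open NearField

/-! Write `E_d(P)` as `ρ(x) = d / (1 - x · e)`, where `e = P / s` and `s = d + √(d² + |P|²)` is the
major axis. The positively homogeneous gauge equal to 1 on this ellipsoid is `(|y| - y · e) / d`,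
which is Lipschitz with constant `2 / d`. A surface enclosed by supporting ellipsoids with `d ≥ a`
has a Lipschitz gauge, so Rademacher's theorem gives a tangent plane in almost every direction.
There, the gradient of the gauge is that of any supporting ellipsoid, so the irradiance is an
explicit function of `(d, P)`.

The reflector map is single-valued almost everywhere. Two distinct foci compatible with the same
point and gradient lie on one reflected ray. If `D` is countable, the direction then lies in one of
countably many proper subspaces. If `D` is planar, the surface point lies in the plane of `D`, and
the vanishing of gradients almost everywhere on a zero set excludes this (`ae_eq_of_gradient`).
Uniqueness together with compactness of the parameters gives measurability and makes the
illumination continuous under pointwise convergence of surfaces (`tendsto_illumination`).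

For finitely many targets (`IsSetting.exists_energyAt_eq`), intersect ellipsoids `E_{b i}(P i)` with
`b i₀ = k a` fixed, and minimise `∑ b i` among those sending at most the prescribed energy to each
`P i`, `i ≠ i₀`. Shrinking one ellipsoid cannot increase the energy of the other targets, so at the
minimum these constraints are equalities. The energy hypothesis keeps the minimiser off the lower
face `b i = a` for `i ≠ i₀` and leaves any surplus at `P i₀`. A general `η` is a limit of finite
sums. Arzelà–Ascoli gives a limiting surface whose reflected measure is `η` plus a nonnegative point
mass at `P₀`, which yields both the inequality and the equality away from `P₀`. -/

namespace NearField

open Filter Topology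
open scoped NNReal ENNReal BoundedContinuousFunction

/-! ### Ellipsoids with one focus at the origin -/

/-- The major axis `|X| + |X - P|` of the ellipsoid `E_d(P)`. -/
noncomputable def majorAxis (d : ℝ) (P : Space) : ℝ := d + √(d ^ 2 + ‖P‖ ^ 2)

/-- The eccentricity vector of `E_d(P)`, pointing to the second focus. -/
noncomputable def eccVec (d : ℝ) (P : Space) : Space := (majorAxis d P)⁻¹ • P

lemma majorAxis_sq (d : ℝ) (P : Space) :
    majorAxis d P ^ 2 - ‖P‖ ^ 2 = 2 * d * majorAxis d P := by
  have h := Real.sq_sqrt (by positivity : 0 ≤ d ^ 2 + ‖P‖ ^ 2)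
  unfold majorAxis
  linear_combination h

lemma norm_lt_majorAxis {d : ℝ} (hd : 0 < d) (P : Space) : ‖P‖ < majorAxis d P := by
  have h : ‖P‖ ≤ √(d ^ 2 + ‖P‖ ^ 2) := Real.le_sqrt_of_sq_le (by nlinarith)
  unfold majorAxis
  linarith

lemma majorAxis_pos {d : ℝ} (hd : 0 < d) (P : Space) : 0 < majorAxis d P :=
  (norm_nonneg P).trans_lt (norm_lt_majorAxis hd P)

lemma majorAxis_lt {d d' : ℝ} (hd : 0 < d) (h : d < d') (P : Space) :
    majorAxis d P < majorAxis d' P := by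
  have : √(d ^ 2 + ‖P‖ ^ 2) ≤ √(d' ^ 2 + ‖P‖ ^ 2) := Real.sqrt_le_sqrt (by gcongr)
  unfold majorAxis
  linarith

lemma norm_eccVec_eq {d : ℝ} (hd : 0 < d) (P : Space) :
    ‖eccVec d P‖ = ‖P‖ / majorAxis d P := by
  rw [eccVec, norm_smul, norm_inv, Real.norm_of_nonneg (majorAxis_pos hd P).le, inv_mul_eq_div]

lemma norm_eccVec_lt_one {d : ℝ} (hd : 0 < d) (P : Space) : ‖eccVec d P‖ < 1 := by
  rw [norm_eccVec_eq hd, div_lt_one (majorAxis_pos hd P)]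
  exact norm_lt_majorAxis hd P

lemma cConst_pos (δ : ℝ) : 0 < cConst δ := by
  have : δ < √(1 + δ ^ 2) := Real.lt_sqrt_of_sq_lt (by linarith)
  unfold cConst
  linarith

lemma cConst_lt_one {δ : ℝ} (hδ : 0 < δ) : cConst δ < 1 := by
  have : √(1 + δ ^ 2) < 1 + δ := by
    rw [Real.sqrt_lt' (by linarith)]
    nlinarith
  unfold cConst
  linarith

/-- For `P ≠ 0` the eccentricity depends only on `d / |P|` and decreases in it. Its value at `d /
|P| = δ` is `1 / (δ + √(1 + δ²)) = c_δ`, and `d ≥ δ M ≥ δ |P|`. -/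
lemma norm_eccVec_le_cConst {δ d M : ℝ} (hδ : 0 < δ) {P : Space} (hP : ‖P‖ ≤ M) (hM : 0 < M)
    (hd : δ * M ≤ d) : ‖eccVec d P‖ ≤ cConst δ := by
  have hd0 : 0 < d := (by positivity : 0 < δ * M).trans_le hd
  rw [norm_eccVec_eq hd0, div_le_iff₀ (majorAxis_pos hd0 P)]
  have hδP : δ * ‖P‖ ≤ d := (by gcongr : δ * ‖P‖ ≤ δ * M).trans hd
  have hsq : √(1 + δ ^ 2) * ‖P‖ ≤ √(d ^ 2 + ‖P‖ ^ 2) := by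
    apply Real.le_sqrt_of_sq_le
    rw [mul_pow, Real.sq_sqrt (by positivity)]
    nlinarith [mul_nonneg hδ.le (norm_nonneg P)]
  have hc : cConst δ * (δ + √(1 + δ ^ 2)) = 1 := by
    have := Real.sq_sqrt (by positivity : 0 ≤ 1 + δ ^ 2)
    unfold cConst
    linear_combination this
  calc ‖P‖ = cConst δ * (δ * ‖P‖ + √(1 + δ ^ 2) * ‖P‖) := by linear_combination (-‖P‖) * hc
    _ ≤ cConst δ * majorAxis d P := by
      have := cConst_pos δ
      unfold majorAxis
      gcongr

lemma norm_sph (x : Sph) : ‖(x : Space)‖ = 1 := norm_eq_of_mem_sphere x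

lemma inner_sph_self (x : Sph) : inner ℝ (x : Space) x = 1 := by
  rw [real_inner_self_eq_norm_sq, norm_sph, one_pow]

lemma abs_inner_sph_le (x : Sph) (y : Space) : |inner ℝ (x : Space) y| ≤ ‖y‖ := by
  simpa [norm_sph] using abs_real_inner_le_norm (x : Space) y

lemma inner_eccVec_lt_one {d : ℝ} (hd : 0 < d) (P : Space) (x : Sph) :
    inner ℝ (x : Space) (eccVec d P) < 1 :=
  (le_abs_self _).trans_lt ((abs_inner_sph_le x _).trans_lt (norm_eccVec_lt_one hd P))

lemma polarRadius_eq {d : ℝ} (hd : 0 < d) (P : Space) (x : Sph) :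
    polarRadius d P x = d / (1 - inner ℝ (x : Space) (eccVec d P)) := by
  rcases eq_or_ne P 0 with rfl | hP
  · simp [polarRadius, eccVec]
  have hP' : 0 < ‖P‖ := norm_pos_iff.2 hP
  have hs := majorAxis_pos hd P
  have h1 : √(1 + d ^ 2 / ‖P‖ ^ 2) = √(d ^ 2 + ‖P‖ ^ 2) / ‖P‖ := by
    rw [show 1 + d ^ 2 / ‖P‖ ^ 2 = (d ^ 2 + ‖P‖ ^ 2) / ‖P‖ ^ 2 by field_simp; ring,
      Real.sqrt_div' _ (by positivity), Real.sqrt_sq hP'.le]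
  have h2 : ecc d P * ‖P‖⁻¹ = (majorAxis d P)⁻¹ := by
    have h := majorAxis_sq d P
    rw [ecc, h1]
    have : √(d ^ 2 + ‖P‖ ^ 2) = majorAxis d P - d := by unfold majorAxis; ring
    rw [this]
    field_simp
    linear_combination h
  rw [polarRadius, eccVec, inner_smul_right, inner_smul_right, ← mul_assoc, h2]

lemma polarRadius_pos {d : ℝ} (hd : 0 < d) (P : Space) (x : Sph) : 0 < polarRadius d P x := by
  rw [polarRadius_eq hd]
  exact div_pos hd (sub_pos.2 (inner_eccVec_lt_one hd P x))

/-- This is `|X| + |X - P| = s` at `X = ρ x`, after squaring. The parameter `d` enters only through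
`s`, which makes monotonicity in `d` algebraic. -/
lemma polarRadius_eq_majorAxis {d : ℝ} (hd : 0 < d) (P : Space) (x : Sph) :
    2 * polarRadius d P x * (majorAxis d P - inner ℝ (x : Space) P) =
      majorAxis d P ^ 2 - ‖P‖ ^ 2 := by
  have h := inner_eccVec_lt_one hd P x
  have hs := majorAxis_pos hd P
  rw [polarRadius_eq hd, majorAxis_sq]
  have h1 : inner ℝ (x : Space) P = majorAxis d P * inner ℝ (x : Space) (eccVec d P) := by
    rw [eccVec, inner_smul_right]
    field_simp
  have h2 : 1 - inner ℝ (x : Space) (eccVec d P) ≠ 0 := by linarith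
  rw [h1]
  field_simp

lemma polarRadius_lt {d d' : ℝ} (hd : 0 < d) (h : d < d') (P : Space) (x : Sph) :
    polarRadius d P x < polarRadius d' P x := by
  have h1 := polarRadius_eq_majorAxis hd P x
  have h2 := polarRadius_eq_majorAxis (hd.trans h) P x
  have hs := majorAxis_lt hd h P
  have hp := norm_lt_majorAxis hd P
  have hq := (abs_le.1 (abs_inner_sph_le x P)).2
  set s := majorAxis d P
  set s' := majorAxis d' P
  set q := inner ℝ (x : Space) P
  have hsq : 0 < s - q := by linarith
  have hsq' : 0 < s' - q := by linarith
  -- Cross-multiplied form of the fact that `s ↦ (s² - |P|²) / (s - q)` increases for `s > |P| ≥ q`.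
  have key : 0 < (s' ^ 2 - ‖P‖ ^ 2) * (s - q) - (s ^ 2 - ‖P‖ ^ 2) * (s' - q) := by
    have : (s' ^ 2 - ‖P‖ ^ 2) * (s - q) - (s ^ 2 - ‖P‖ ^ 2) * (s' - q) =
      (s' - s) * ((s - ‖P‖) * (s' - ‖P‖) + (‖P‖ - q) * (s + s')) := by ring
    rw [this]
    have h3 : 0 < (s - ‖P‖) * (s' - ‖P‖) := mul_pos (by linarith) (by linarith)
    have h4 : 0 ≤ (‖P‖ - q) * (s + s') :=
      mul_nonneg (by linarith) (by linarith [norm_nonneg P])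
    exact mul_pos (by linarith) (by linarith)
  rw [← h1, ← h2] at key
  have h5 : 0 < 2 * ((s - q) * (s' - q)) * (polarRadius d' P x - polarRadius d P x) := by
    linarith
  have := pos_of_mul_pos_right h5 (by positivity)
  linarith

lemma polarRadius_mono {d d' : ℝ} (hd : 0 < d) (h : d ≤ d') (P : Space) (x : Sph) :
    polarRadius d P x ≤ polarRadius d' P x := by
  rcases h.eq_or_lt with rfl | h
  · rfl
  · exact (polarRadius_lt hd h P x).le

lemma polarRadius_injective {d d' : ℝ} (hd : 0 < d) (hd' : 0 < d') {P : Space} {x : Sph}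
    (h : polarRadius d P x = polarRadius d' P x) : d = d' := by
  rcases lt_trichotomy d d' with h1 | h1 | h1
  · exact absurd h (polarRadius_lt hd h1 P x).ne
  · exact h1
  · exact absurd h (polarRadius_lt hd' h1 P x).ne'

lemma le_polarRadius {d c : ℝ} (hd : 0 < d) {P : Space} (hc : ‖eccVec d P‖ ≤ c) (x : Sph) :
    d / (1 + c) ≤ polarRadius d P x := by
  rw [polarRadius_eq hd]
  have h := inner_eccVec_lt_one hd P x
  have h' := abs_le.1 (abs_inner_sph_le x (eccVec d P))
  exact div_le_div_of_nonneg_left hd.le (by linarith) (by linarith)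

lemma polarRadius_le {d c : ℝ} (hd : 0 < d) {P : Space} (hc : ‖eccVec d P‖ ≤ c) (hc1 : c < 1)
    (x : Sph) : polarRadius d P x ≤ d / (1 - c) := by
  rw [polarRadius_eq hd]
  have h' := abs_le.1 (abs_inner_sph_le x (eccVec d P))
  exact div_le_div_of_nonneg_left hd.le (by linarith) (by linarith)

/-- Since the eccentricity is below 1, an upper bound `R` for the surface bounds the parameters of
all supporting ellipsoids by `2 R`, which confines them to a compact set. -/
lemma lt_two_mul_polarRadius {d : ℝ} (hd : 0 < d) (P : Space) (x : Sph) :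
    d < 2 * polarRadius d P x := by
  have h1 := norm_eccVec_lt_one hd P
  have h2 := le_polarRadius hd le_rfl (P := P) x
  have h3 : d / 2 < d / (1 + ‖eccVec d P‖) :=
    div_lt_div_of_pos_left hd (by positivity) (by linarith)
  linarith

lemma continuous_majorAxis : Continuous fun z : ℝ × Space => majorAxis z.1 z.2 := by
  unfold majorAxis
  fun_prop

lemma continuousAt_eccVec {z : ℝ × Space} (hz : 0 < z.1) :
    ContinuousAt (fun z : ℝ × Space => eccVec z.1 z.2) z := by
  unfold eccVec
  exact (continuous_majorAxis.continuousAt.inv₀ (majorAxis_pos hz _).ne').smul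
    continuous_snd.continuousAt

lemma continuousAt_polarRadius {w : (ℝ × Space) × Sph} (hw : 0 < w.1.1) :
    ContinuousAt (fun w : (ℝ × Space) × Sph => polarRadius w.1.1 w.1.2 w.2) w := by
  have h : ContinuousAt
      (fun w : (ℝ × Space) × Sph => w.1.1 / (1 - inner ℝ (w.2 : Space) (eccVec w.1.1 w.1.2))) w := by
    refine ContinuousAt.div (by fun_prop) ?_
      (sub_pos.2 (inner_eccVec_lt_one hw w.1.2 w.2)).ne'
    refine continuousAt_const.sub (ContinuousAt.inner (𝕜 := ℝ) (by fun_prop) ?_)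
    exact ContinuousAt.comp (f := Prod.fst) (x := w) (continuousAt_eccVec hw) continuousAt_fst
  refine h.congr ?_
  have : ∀ᶠ v : (ℝ × Space) × Sph in 𝓝 w, 0 < v.1.1 :=
    (continuous_fst.comp continuous_fst).continuousAt.eventually (lt_mem_nhds hw)
  filter_upwards [this] with v hv
  exact (polarRadius_eq hv _ _).symm

lemma continuousAt_polarRadius_left {z : ℝ × Space} (hz : 0 < z.1) (x : Sph) :
    ContinuousAt (fun z : ℝ × Space => polarRadius z.1 z.2 x) z :=
  ContinuousAt.comp (f := fun z : ℝ × Space => (z, x)) (continuousAt_polarRadius (w := (z, x)) hz)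
    (by fun_prop)

/-- The value of `(x · ν(x)) / ρ(x)²` for the surface `E_d(P)`. -/
noncomputable def ellDensity (d : ℝ) (P : Space) (x : Sph) : ℝ :=
  (1 - inner ℝ (x : Space) (eccVec d P)) ^ 3 / (d ^ 2 * ‖(x : Space) - eccVec d P‖)

lemma one_sub_inner_le_norm (x : Sph) (e : Space) :
    1 - inner ℝ (x : Space) e ≤ ‖(x : Space) - e‖ := by
  have h := (le_abs_self _).trans (abs_inner_sph_le x ((x : Space) - e))
  rwa [inner_sub_right, inner_sph_self] at h

lemma norm_sub_eccVec_pos {d : ℝ} (hd : 0 < d) (P : Space) (x : Sph) :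
    0 < ‖(x : Space) - eccVec d P‖ :=
  (sub_pos.2 (inner_eccVec_lt_one hd P x)).trans_le (one_sub_inner_le_norm x _)

lemma ellDensity_nonneg {d : ℝ} (hd : 0 < d) (P : Space) (x : Sph) : 0 ≤ ellDensity d P x := by
  have := inner_eccVec_lt_one hd P x
  have : 0 ≤ 1 - inner ℝ (x : Space) (eccVec d P) := by linarith
  unfold ellDensity
  positivity

lemma ellDensity_le {a d : ℝ} (ha : 0 < a) (hd : a ≤ d) (P : Space) (x : Sph) :
    ellDensity d P x ≤ 4 / a ^ 2 := by
  have hd0 := ha.trans_le hd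
  have h1 := inner_eccVec_lt_one hd0 P x
  have h2 := norm_sub_eccVec_pos hd0 P x
  have h3 := one_sub_inner_le_norm x (eccVec d P)
  have h4 := (abs_le.1 (abs_inner_sph_le x (eccVec d P))).1
  have h5 := norm_eccVec_lt_one hd0 P
  set t := 1 - inner ℝ (x : Space) (eccVec d P)
  set n := ‖(x : Space) - eccVec d P‖
  have ht : 0 ≤ t := by simp only [t]; linarith
  have ht2 : t ≤ 2 := by simp only [t]; linarith
  unfold ellDensity
  calc t ^ 3 / (d ^ 2 * n) ≤ (2 ^ 2 * n) / (d ^ 2 * n) := by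
        gcongr
        calc t ^ 3 = t ^ 2 * t := by ring
          _ ≤ 2 ^ 2 * n := by gcongr
    _ = 4 / d ^ 2 := by field_simp; norm_num
    _ ≤ 4 / a ^ 2 := by gcongr

lemma continuousAt_ellDensity_left {z : ℝ × Space} (hz : 0 < z.1) (x : Sph) :
    ContinuousAt (fun z : ℝ × Space => ellDensity z.1 z.2 x) z := by
  have := continuousAt_eccVec hz
  have h2 := norm_sub_eccVec_pos hz z.2 x
  unfold ellDensity
  refine ContinuousAt.div ?_ ?_ (by positivity)
  · exact (continuousAt_const.sub (continuousAt_const.inner (𝕜 := ℝ) this)).pow 3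
  · exact (continuousAt_fst.pow 2).mul (continuousAt_const.sub this).norm

lemma le_ellDensity {d c R : ℝ} (hd : 0 < d) {P : Space} (hc : ‖eccVec d P‖ ≤ c)
    (hc1 : c < 1) {x : Sph} (hR : polarRadius d P x ≤ R) :
    (1 - c) / (1 + c) / R ^ 2 ≤ ellDensity d P x := by
  have h0 := polarRadius_pos hd P x
  have h1 := inner_eccVec_lt_one hd P x
  have h2 := norm_sub_eccVec_pos hd P x
  have h3 := (abs_le.1 (abs_inner_sph_le x (eccVec d P))).2.trans hc
  have h4 : ‖(x : Space) - eccVec d P‖ ≤ 1 + c :=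
    (norm_sub_le _ _).trans (by rw [norm_sph]; linarith)
  have hc0 : 0 ≤ c := (norm_nonneg _).trans hc
  -- The factor before `ρ⁻²` is the cosine `x · ν`; its numerator is at least `1 - c` and its
  -- denominator at most `1 + c`.
  have hE : ellDensity d P x = (1 - inner ℝ (x : Space) (eccVec d P)) /
      ‖(x : Space) - eccVec d P‖ / polarRadius d P x ^ 2 := by
    rw [polarRadius_eq hd, ellDensity]
    have : 1 - inner ℝ (x : Space) (eccVec d P) ≠ 0 := by linarith
    field_simp
  rw [hE]
  have : 0 ≤ 1 - inner ℝ (x : Space) (eccVec d P) := by linarith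
  have h5 : 0 < 1 - c := by linarith
  gcongr

/-! ### Null sets of directions -/

/-- In polar coordinates Lebesgue measure is a product, so by Fubini almost every ray meets the
property at almost every radius, and `hp` needs only one radius. This transfers Rademacher's theorem
and the nullity of subspaces to the sphere. -/
lemma ae_sph_of_ae_of_cone {p : Space → Prop} (h : ∀ᵐ y : Space, p y)
    (hp : ∀ (x : Sph) (t : ℝ), 0 < t → p (t • (x : Space)) → p x) : ∀ᵐ x : Sph ∂surf, p x := by
  have hmp := (volume : Measure Space).measurePreserving_homeomorphUnitSphereProd
  have hemb := (homeomorphUnitSphereProd Space).measurableEmbedding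
  have h0 : ∀ᵐ y : ({0}ᶜ : Set Space)
      ∂((volume : Measure Space).comap ((↑) : ({0}ᶜ : Set Space) → Space)), p y := by
    have hc := MeasurableEmbedding.subtype_coe (measurableSet_singleton (0 : Space)).compl
    rw [← hc.ae_map_iff, hc.map_comap]
    exact ae_restrict_of_ae h
  have h1 : ∀ᵐ z ∂((volume : Measure Space).toSphere.prod
      (Measure.volumeIoiPow (Module.finrank ℝ Space - 1))),
      p ((z.2 : ℝ) • (z.1 : Space)) := by
    rw [← hmp.map_eq, hemb.ae_map_iff]
    filter_upwards [h0] with y hy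
    have hy0 : ‖(y : Space)‖ ≠ 0 := norm_ne_zero_iff.2 y.2
    simpa [smul_smul, hy0] using hy
  have h2 := Measure.ae_ae_of_ae_prod h1
  -- The radial measure must be nonzero for an almost everywhere statement to produce an actual
  -- radius.
  have : NeZero (Measure.volumeIoiPow (Module.finrank ℝ Space - 1)) := ⟨fun h => by
    have := Measure.volumeIoiPow_apply_Iio (Module.finrank ℝ Space - 1) ⟨1, mem_Ioi.2 one_pos⟩
    rw [h] at this
    have h3 : (0 : ℝ) < (2 + 1)⁻¹ := by norm_num
    simp [h3.not_ge] at this⟩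
  filter_upwards [h2] with x hx
  obtain ⟨t, ht⟩ := hx.exists
  exact hp x t t.2 ht

lemma ae_sph_notMem_submodule {V : Submodule ℝ Space} (hV : V ≠ ⊤) :
    ∀ᵐ x : Sph ∂surf, (x : Space) ∉ V := by
  refine ae_sph_of_ae_of_cone (p := fun y => y ∉ V) ?_ fun x t ht h hx => h (V.smul_mem t hx)
  exact measure_eq_zero_iff_ae_notMem.1 (Measure.addHaar_submodule volume V hV)

/-! ### The gauge of a surface -/

lemma direction_smul {t : ℝ} (ht : 0 < t) (x : Sph) (h : t • (x : Space) ≠ 0) :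
    direction (t • (x : Space)) h = x := by
  ext1
  simp only [direction, norm_smul, norm_sph, Real.norm_of_nonneg ht.le, mul_one, smul_smul,
    inv_mul_cancel₀ ht.ne', one_smul]

lemma norm_smul_direction (y : Space) (hy : y ≠ 0) : ‖y‖ • (direction y hy : Space) = y := by
  simp [direction, smul_smul, hy]

open Classical in
/-- The positively homogeneous function equal to `1` on the surface `{ρ(x) x}`. -/
noncomputable def radialGauge (ρ : Sph → ℝ) (y : Space) : ℝ :=
  if hy : y ≠ 0 then ‖y‖ / ρ (direction y hy) else 0

lemma radialGauge_of_ne (ρ : Sph → ℝ) {y : Space} (hy : y ≠ 0) :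
    radialGauge ρ y = ‖y‖ / ρ (direction y hy) := dif_pos hy

lemma radialGauge_zero (ρ : Sph → ℝ) : radialGauge ρ 0 = 0 := by simp [radialGauge]

lemma radialGauge_smul_sph (ρ : Sph → ℝ) {t : ℝ} (ht : 0 < t) (x : Sph) :
    radialGauge ρ (t • (x : Space)) = t / ρ x := by
  have h : t • (x : Space) ≠ 0 := by
    rw [← norm_ne_zero_iff, norm_smul, norm_sph]
    simpa using ht.ne'
  rw [radialGauge_of_ne ρ h, direction_smul ht, norm_smul, norm_sph,
    Real.norm_of_nonneg ht.le, mul_one]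

lemma radialGauge_sph (ρ : Sph → ℝ) (x : Sph) : radialGauge ρ x = 1 / ρ x := by
  simpa using radialGauge_smul_sph ρ one_pos x

lemma radialGauge_smul (ρ : Sph → ℝ) {t : ℝ} (ht : 0 < t) (y : Space) :
    radialGauge ρ (t • y) = t * radialGauge ρ y := by
  rcases eq_or_ne y 0 with rfl | hy
  · simp [radialGauge_zero]
  · have hy' : 0 < ‖y‖ := norm_pos_iff.2 hy
    rw [← norm_smul_direction y hy, smul_smul, radialGauge_smul_sph ρ (by positivity),
      radialGauge_smul_sph ρ hy']
    ring

lemma levelFn_eq (ρ : Sph → ℝ) :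
    levelFn ρ = fun y => ‖y‖ - ‖y‖ / radialGauge ρ y := by
  ext y
  by_cases hy : y = 0
  · simp [levelFn, hy]
  · have hy' : ‖y‖ ≠ 0 := norm_ne_zero_iff.2 hy
    simp only [levelFn, radialGauge, ne_eq, hy, not_false_eq_true, dite_true]
    rw [div_div_cancel₀ hy']

lemma radialGauge_polarRadius {d : ℝ} (hd : 0 < d) (P : Space) :
    radialGauge (polarRadius d P) = fun y => (‖y‖ - inner ℝ y (eccVec d P)) / d := by
  ext y
  rcases eq_or_ne y 0 with rfl | hy
  · simp [radialGauge_zero]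
  · have hy' : 0 < ‖y‖ := norm_pos_iff.2 hy
    have h := inner_eccVec_lt_one hd P (direction y hy)
    rw [radialGauge_of_ne _ hy, polarRadius_eq hd]
    have h2 : inner ℝ y (eccVec d P) =
        ‖y‖ * inner ℝ (direction y hy : Space) (eccVec d P) := by
      conv_lhs => rw [← norm_smul_direction y hy]
      rw [real_inner_smul_left]
    rw [h2, div_div_eq_mul_div]
    ring

lemma radialGauge_anti {ρ ρ' : Sph → ℝ} {y : Space} (hy : y ≠ 0)
    (hpos : 0 < ρ (direction y hy)) (h : ρ (direction y hy) ≤ ρ' (direction y hy)) :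
    radialGauge ρ' y ≤ radialGauge ρ y := by
  rw [radialGauge_of_ne _ hy, radialGauge_of_ne _ hy]
  gcongr

lemma lipschitzWith_radialGauge_polarRadius {a d : ℝ} (ha : 0 < a) (hd : a ≤ d) (P : Space) :
    LipschitzWith (2 / a).toNNReal (radialGauge (polarRadius d P)) := by
  have hd0 := ha.trans_le hd
  rw [radialGauge_polarRadius hd0]
  refine LipschitzWith.of_le_add_mul' _ fun x y => ?_
  have h1 : ‖x‖ - ‖y‖ ≤ ‖x - y‖ := norm_sub_norm_le x y
  have h2 : |inner ℝ (y - x) (eccVec d P)| ≤ ‖y - x‖ * 1 :=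
    (abs_real_inner_le_norm _ _).trans (by gcongr; exact (norm_eccVec_lt_one hd0 P).le)
  rw [inner_sub_left, norm_sub_rev] at h2
  have h3 := (abs_le.1 h2).2
  have h4 : ‖x - y‖ / d ≤ ‖x - y‖ / a := by gcongr
  rw [dist_eq_norm]
  have h5 : (‖x‖ - inner ℝ x (eccVec d P)) ≤
      (‖y‖ - inner ℝ y (eccVec d P)) + 2 * ‖x - y‖ := by linarith
  calc (‖x‖ - inner ℝ x (eccVec d P)) / d
      ≤ ((‖y‖ - inner ℝ y (eccVec d P)) + 2 * ‖x - y‖) / d := by gcongr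
    _ = (‖y‖ - inner ℝ y (eccVec d P)) / d + 2 * (‖x - y‖ / d) := by ring
    _ ≤ (‖y‖ - inner ℝ y (eccVec d P)) / d + 2 * (‖x - y‖ / a) := by gcongr
    _ = _ := by ring

/-! ### First order contact -/

lemma hasFDerivAt_norm_smul_sph {t : ℝ} (ht : 0 < t) (x : Sph) :
    HasFDerivAt (fun y : Space => ‖y‖) (innerSL ℝ (x : Space)) (t • (x : Space)) := by
  have hn : ‖t • (x : Space)‖ = t := by
    rw [norm_smul, norm_sph, Real.norm_of_nonneg ht.le, mul_one]
  have h := (hasStrictFDerivAt_norm_sq (t • (x : Space))).hasFDerivAt.sqrt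
    (by rw [hn]; positivity)
  simp only [Real.sqrt_sq (norm_nonneg _)] at h
  refine h.congr_fderiv ?_
  ext v
  simp [hn]
  field_simp

lemma hasFDerivAt_norm_sph (x : Sph) :
    HasFDerivAt (fun y : Space => ‖y‖) (innerSL ℝ (x : Space)) x := by
  simpa using hasFDerivAt_norm_smul_sph one_pos x

/-- The gauge of the surface minus that of the ellipsoid has a local minimum at `x`. The support
inequality holds only over `closure Ω`, hence the need for an interior point. -/
lemma fderiv_radialGauge_of_supports {Ω : Set Sph} {ρ : Sph → ℝ} (hρ : ∀ x, 0 < ρ x) {x : Sph}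
    (hx : x ∈ interior (closure Ω)) {d : ℝ} {P : Space} (hS : Supports Ω ρ d P x)
    {L : Space →L[ℝ] ℝ} (hL : HasFDerivAt (radialGauge ρ) L x) :
    L = innerSL ℝ (d⁻¹ • ((x : Space) - eccVec d P)) := by
  obtain ⟨hd, hle, heq⟩ := hS
  have hE : HasFDerivAt (radialGauge (polarRadius d P))
      (d⁻¹ • (innerSL ℝ (x : Space) - innerSL ℝ (eccVec d P))) x := by
    rw [radialGauge_polarRadius hd]
    have := ((hasFDerivAt_norm_sph x).sub
      (innerSL ℝ (eccVec d P)).hasFDerivAt).const_smul d⁻¹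
    refine this.congr_of_eventuallyEq (Eventually.of_forall fun y => ?_)
    simp [real_inner_comm, div_eq_inv_mul]
  have hmin : IsLocalMin (radialGauge ρ - radialGauge (polarRadius d P)) x := by
    have hU : closure Ω ∈ 𝓝 x := mem_interior_iff_mem_nhds.1 hx
    rw [mem_nhds_subtype] at hU
    obtain ⟨U, hU, hUs⟩ := hU
    have hx0 : (x : Space) ≠ 0 := by
      rw [← norm_ne_zero_iff, norm_sph]; exact one_ne_zero
    have hc : ContinuousAt (fun y : Space => ‖y‖⁻¹ • y) x :=
      (continuous_norm.continuousAt.inv₀ (norm_ne_zero_iff.2 hx0)).smul continuousAt_id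
    have hUx : U ∈ 𝓝 (‖(x : Space)‖⁻¹ • (x : Space)) := by simpa [norm_sph] using hU
    filter_upwards [hc hUx, isOpen_ne.mem_nhds hx0] with y hy hy0
    have hyΩ : direction y hy0 ∈ closure Ω := hUs hy
    have := radialGauge_anti hy0 (hρ _) (hle _ hyΩ)
    simp only [Pi.sub_apply, radialGauge_sph, heq, sub_self]
    linarith
  have := hmin.hasFDerivAt_eq_zero (hL.sub hE)
  rw [sub_eq_zero] at this
  rw [this, map_smul, map_sub]

lemma hasFDerivAt_radialGauge_smul {ρ : Sph → ℝ} {y : Space} {L : Space →L[ℝ] ℝ} {t : ℝ}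
    (ht : 0 < t) (hL : HasFDerivAt (radialGauge ρ) L y) :
    HasFDerivAt (radialGauge ρ) L (t • y) := by
  have h1 : HasFDerivAt (fun z : Space => t⁻¹ • z) (t⁻¹ • ContinuousLinearMap.id ℝ Space)
      (t • y) := (hasFDerivAt_id _).const_smul t⁻¹
  have h2 : HasFDerivAt (radialGauge ρ) L (t⁻¹ • t • y) := by
    rwa [smul_smul, inv_mul_cancel₀ ht.ne', one_smul]
  have h3 := (h2.comp (t • y) h1).const_smul t
  have h4 : t • L.comp (t⁻¹ • ContinuousLinearMap.id ℝ Space) = L := by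
    ext v
    simp [ht.ne']
  rw [h4] at h3
  refine h3.congr_of_eventuallyEq (Eventually.of_forall fun z => ?_)
  simp [radialGauge_smul ρ (inv_pos.2 ht), ht.ne']

/-- With gauge `G`, the level function is `|y| - |y| / G`. On the surface `G = 1`, so the two
derivatives of the norm cancel and only `ρ(x) dG` remains; `dG` is constant along rays. -/
lemma hasFDerivAt_levelFn {ρ : Sph → ℝ} {x : Sph} (hρ : 0 < ρ x) {L : Space →L[ℝ] ℝ}
    (hL : HasFDerivAt (radialGauge ρ) L x) :
    HasFDerivAt (levelFn ρ) (ρ x • L) (ρ x • (x : Space)) := by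
  have h1 := hasFDerivAt_radialGauge_smul hρ hL
  have h2 := hasFDerivAt_norm_smul_sph hρ x
  have h3 : radialGauge ρ (ρ x • (x : Space)) = 1 := by
    rw [radialGauge_smul_sph ρ hρ, div_self hρ.ne']
  have h4 := h2.sub (h2.mul ((hasDerivAt_inv (by rw [h3]; exact one_ne_zero)).comp_hasFDerivAt
    (ρ x • (x : Space)) h1))
  rw [levelFn_eq]
  simp only [div_eq_mul_inv]
  refine HasFDerivAt.congr_fderiv h4 ?_
  ext v
  simp [h3, norm_smul, abs_of_pos hρ]

lemma irradiance_eq_of_supports {Ω : Set Sph} {ρ : Sph → ℝ} (hρ : ∀ x, 0 < ρ x) {x : Sph}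
    (hx : x ∈ interior (closure Ω)) (hdiff : DifferentiableAt ℝ (radialGauge ρ) x)
    {d : ℝ} {P : Space} (hS : Supports Ω ρ d P x) (f : Sph → ℝ) :
    irradiance f ρ x = f x * ellDensity d P x := by
  have hL := fderiv_radialGauge_of_supports hρ hx hS hdiff.hasFDerivAt
  have h1 := hasFDerivAt_levelFn (hρ x) hdiff.hasFDerivAt
  obtain ⟨hd, -, heq⟩ := hS
  have hg : gradient (levelFn ρ) (ρ x • (x : Space)) =
      (ρ x * d⁻¹) • ((x : Space) - eccVec d P) := by
    refine HasGradientAt.gradient ?_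
    rw [hasGradientAt_iff_hasFDerivAt]
    refine h1.congr_fderiv ?_
    rw [hL]
    ext v
    simp [mul_assoc]
  have hn := norm_sub_eccVec_pos hd P x
  have hlt := inner_eccVec_lt_one hd P x
  have hne : 1 - inner ℝ (x : Space) (eccVec d P) ≠ 0 := by linarith
  have hρx := hρ x
  have hq : 0 < ρ x * d⁻¹ := by positivity
  rw [irradiance, outerNormal, hg, norm_smul, Real.norm_of_nonneg hq.le, real_inner_smul_right,
    real_inner_smul_right, inner_sub_right, inner_sph_self, ellDensity, heq, polarRadius_eq hd]
  field_simp

/-! ### Uniqueness of the supporting ellipsoid -/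

/-- For fixed `x`, `ρ(x)` and `g`, the second relation makes `κ = d s` an affine function of `s`.
The first then confines `P` to a line parametrised by `s`: the reflected ray, with `s = ρ(x)` giving
the surface point itself. -/
lemma focus_eq_of_gradient {d : ℝ} (hd : 0 < d) {P : Space} {x : Sph} {g : Space}
    (hg : g = d⁻¹ • ((x : Space) - eccVec d P)) :
    P = majorAxis d P • (x : Space) - (d * majorAxis d P) • g ∧
      d * majorAxis d P * (‖g‖ ^ 2 * polarRadius d P x) =
        2 * (majorAxis d P - polarRadius d P x) ∧
      inner ℝ (x : Space) g * polarRadius d P x = 1 := by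
  have hs := majorAxis_pos hd P
  have h1 : P = majorAxis d P • (x : Space) - (d * majorAxis d P) • g := by
    rw [hg, eccVec, smul_smul, smul_sub, smul_smul, mul_right_comm, mul_inv_cancel₀ hd.ne',
      one_mul, mul_inv_cancel₀ hs.ne', one_smul, sub_sub_cancel]
  have hlt := inner_eccVec_lt_one hd P x
  have hx : inner ℝ (x : Space) g * polarRadius d P x = 1 := by
    rw [hg, polarRadius_eq hd, real_inner_smul_right, inner_sub_right, inner_sph_self]
    have : 1 - inner ℝ (x : Space) (eccVec d P) ≠ 0 := by linarith
    field_simp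
  refine ⟨h1, ?_, hx⟩
  have h2 : ‖P‖ ^ 2 = majorAxis d P ^ 2 -
      2 * (majorAxis d P * (d * majorAxis d P) * inner ℝ (x : Space) g) +
      (d * majorAxis d P) ^ 2 * ‖g‖ ^ 2 := by
    conv_lhs => rw [h1]
    rw [norm_sub_sq_real, norm_smul, norm_smul, norm_sph, mul_one, mul_pow,
      Real.norm_eq_abs, Real.norm_eq_abs, sq_abs, sq_abs, real_inner_smul_left,
      real_inner_smul_right]
    ring
  have h3 := majorAxis_sq d P
  have hκ : d * majorAxis d P ≠ 0 := by positivity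
  apply mul_left_cancel₀ hκ
  linear_combination (-polarRadius d P x) * (h2 + h3) + 2 * majorAxis d P * (d * majorAxis d P) * hx

/-- Distinct foci determine the line of the reflected ray, which passes through `ρ(x) x`. A plane
containing both foci therefore contains the surface point and the reflected direction; these are the
two equations for `n`. -/
lemma eq_or_mem_span_of_gradient {d₁ d₂ : ℝ} (h₁ : 0 < d₁) (h₂ : 0 < d₂) {P₁ P₂ : Space}
    {x : Sph} {g : Space} (hg₁ : g = d₁⁻¹ • ((x : Space) - eccVec d₁ P₁))
    (hg₂ : g = d₂⁻¹ • ((x : Space) - eccVec d₂ P₂))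
    (hr : polarRadius d₁ P₁ x = polarRadius d₂ P₂ x) :
    P₁ = P₂ ∨ ((x : Space) ∈ Submodule.span ℝ {P₁, P₂} ∧
      ∀ (n : Space) (c : ℝ), inner ℝ n P₁ = c → inner ℝ n P₂ = c →
        inner ℝ n (x : Space) * polarRadius d₁ P₁ x = c ∧ 2 * inner ℝ n g = c * ‖g‖ ^ 2) := by
  obtain ⟨hP₁, hκ₁, hx⟩ := focus_eq_of_gradient h₁ hg₁
  obtain ⟨hP₂, hκ₂, -⟩ := focus_eq_of_gradient h₂ hg₂
  have hρ := polarRadius_pos h₁ P₁ x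
  rw [← hr] at hκ₂
  set ρ := polarRadius d₁ P₁ x
  set s₁ := majorAxis d₁ P₁
  set s₂ := majorAxis d₂ P₂
  set κ₁ := d₁ * s₁
  set κ₂ := d₂ * s₂
  have hg0 : g ≠ 0 := by
    rintro rfl
    simp at hx
  have hG : 0 < ‖g‖ ^ 2 := by have := norm_pos_iff.2 hg0; positivity
  by_cases hs : s₁ = s₂
  · left
    have : κ₁ = κ₂ := by
      rw [← hs, ← hκ₁] at hκ₂
      exact (mul_right_cancel₀ (by positivity) hκ₂).symm
    rw [hP₁, hP₂, hs, this]
  · right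
    constructor
    -- This determinant is a nonzero multiple of `ρ (s₂ - s₁)`; inverting it eliminates `g` from the
    -- two formulas for the foci.
    · have hne : κ₂ * s₁ - κ₁ * s₂ ≠ 0 := by
        intro h0
        have : 2 * ρ * (s₂ - s₁) = 0 := by
          linear_combination (‖g‖ ^ 2 * ρ) * h0 - s₁ * hκ₂ + s₂ * hκ₁
        rcases mul_eq_zero.1 this with h | h
        · linarith
        · exact hs (by linarith)
      have hxe : (x : Space) = (κ₂ * s₁ - κ₁ * s₂)⁻¹ • (κ₂ • P₁ - κ₁ • P₂) := by
        rw [eq_inv_smul_iff₀ hne, hP₁, hP₂]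
        module
      rw [hxe]
      refine Submodule.smul_mem _ _ (Submodule.sub_mem _ ?_ ?_) <;>
        exact Submodule.smul_mem _ _ (Submodule.subset_span (by simp))
    · intro n c hn₁ hn₂
      rw [hP₁, inner_sub_right, real_inner_smul_right, real_inner_smul_right] at hn₁
      rw [hP₂, inner_sub_right, real_inner_smul_right, real_inner_smul_right] at hn₂
      set p := inner ℝ n (x : Space)
      set q := inner ℝ n g
      have hp : ‖g‖ ^ 2 * ρ * p = 2 * q := by
        have : (s₁ - s₂) * (‖g‖ ^ 2 * ρ * p - 2 * q) = 0 := by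
          linear_combination (‖g‖ ^ 2 * ρ) * (hn₁ - hn₂) + q * (hκ₁ - hκ₂)
        rcases mul_eq_zero.1 this with h | h
        · exact absurd (sub_eq_zero.1 h) hs
        · linarith
      have hq : 2 * q = c * ‖g‖ ^ 2 := by
        apply mul_right_cancel₀ hρ.ne'
        linear_combination (‖g‖ ^ 2 * ρ) * hn₁ + q * hκ₁ - s₁ * hp
      refine ⟨?_, hq⟩
      apply mul_right_cancel₀ hG.ne'
      linear_combination hp + hq

lemma ae_fderiv_eq_zero_of_eq_zero {F : Space → ℝ} (hF : Measurable F) :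
    ∀ᵐ y : Space, F y = 0 → DifferentiableAt ℝ F y → fderiv ℝ F y = 0 := by
  -- The vanishing of the derivative at almost every point of the zero set comes from an estimate
  -- for self-maps of the space, so `F` is multiplied by a fixed vector. On the zero set the product
  -- is approximated by the zero map with error constant 0.
  obtain ⟨v, hv⟩ := exists_ne (0 : Space)
  set s : Set Space := {y | F y = 0} ∩ {y | DifferentiableAt ℝ F y}
  have hs : MeasurableSet s :=
    (measurableSet_eq_fun hF measurable_const).inter (measurableSet_of_differentiableAt ℝ F)
  have happ : ApproximatesLinearOn (fun y => F y • v) (0 : Space →L[ℝ] Space) s 0 := by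
    intro y hy z hz
    have h1 : F y = 0 := hy.1
    have h2 : F z = 0 := hz.1
    simp [h1, h2]
  have h := happ.norm_fderiv_sub_le volume hs (fun y => (fderiv ℝ F y).smulRight v)
    (fun y hy => (hy.2.hasFDerivAt.smul_const v).hasFDerivWithinAt)
  rw [ae_restrict_iff' hs] at h
  filter_upwards [h] with y hy h0 hd
  have h1 := hy ⟨h0, hd⟩
  simp only [sub_zero, nonpos_iff_eq_zero, nnnorm_eq_zero] at h1
  ext w
  have h2 : fderiv ℝ F y w • v = 0 := by
    rw [← ContinuousLinearMap.smulRight_apply, h1]; rfl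
  simpa [hv] using h2

lemma differentiableAt_radialGauge_of_smul {ρ : Sph → ℝ} {y : Space} {t : ℝ} (ht : 0 < t)
    (h : DifferentiableAt ℝ (radialGauge ρ) (t • y)) : DifferentiableAt ℝ (radialGauge ρ) y := by
  have := (hasFDerivAt_radialGauge_smul (inv_pos.2 ht) h.hasFDerivAt).differentiableAt
  rwa [smul_smul, inv_mul_cancel₀ ht.ne', one_smul] at this

lemma ae_differentiableAt_radialGauge {ρ : Sph → ℝ} {L : ℝ≥0}
    (hlip : LipschitzWith L (radialGauge ρ)) :
    ∀ᵐ x : Sph ∂surf, DifferentiableAt ℝ (radialGauge ρ) x :=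
  ae_sph_of_ae_of_cone hlip.ae_differentiableAt
    fun _ _ ht h => differentiableAt_radialGauge_of_smul ht h

/-- The homogeneous function `n · y - c G(y)` vanishes on the cone over the directions whose surface
point lies in the plane `n · y = c`. Its gradient vanishes almost everywhere on that cone. -/
lemma ae_eq_smul_fderiv_radialGauge {ρ : Sph → ℝ} {L : ℝ≥0}
    (hlip : LipschitzWith L (radialGauge ρ)) (n : Space) (c : ℝ) :
    ∀ᵐ x : Sph ∂surf, inner ℝ n (x : Space) = c / ρ x →
      innerSL ℝ n = c • fderiv ℝ (radialGauge ρ) x := by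
  set F : Space → ℝ := fun y => innerSL ℝ n y - c • radialGauge ρ y
  have hF : Measurable F := by
    have := hlip.continuous
    exact Continuous.measurable (by fun_prop)
  have h0 := (ae_fderiv_eq_zero_of_eq_zero hF).and (hlip.ae_differentiableAt (μ := volume))
  have h1 : ∀ᵐ x : Sph ∂surf, F x = 0 → innerSL ℝ n = c • fderiv ℝ (radialGauge ρ) x := by
    refine ae_sph_of_ae_of_cone
      (p := fun y => F y = 0 → innerSL ℝ n = c • fderiv ℝ (radialGauge ρ) y) ?_ ?_
    · filter_upwards [h0] with y hy hFy
      have hF' : HasFDerivAt F (innerSL ℝ n - c • fderiv ℝ (radialGauge ρ) y) y :=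
        (innerSL ℝ n).hasFDerivAt.sub (hy.2.hasFDerivAt.const_smul c)
      have := hy.1 hFy hF'.differentiableAt
      rw [hF'.fderiv, sub_eq_zero] at this
      exact this
    · intro x t ht h hx
      have hFt : F (t • (x : Space)) = 0 := by
        have : F (t • (x : Space)) = t * F x := by
          simp only [F, radialGauge_smul ρ ht, map_smul, smul_eq_mul]
          ring
        rw [this, hx, mul_zero]
      have h2 := h hFt
      by_cases hd : DifferentiableAt ℝ (radialGauge ρ) x
      · rw [h2, (hasFDerivAt_radialGauge_smul ht hd.hasFDerivAt).fderiv]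
      -- By homogeneity, differentiability fails along the whole ray, and both `fderiv`s have the
      -- default value 0.
      · rw [h2, fderiv_zero_of_not_differentiableAt hd, fderiv_zero_of_not_differentiableAt
          (fun h => hd (differentiableAt_radialGauge_of_smul ht h))]
  filter_upwards [h1] with x hx h
  apply hx
  simp [F, radialGauge_sph, h, div_eq_mul_inv]

/-- At almost every direction two ellipsoids with second focus in `D` cannot touch the surface
`{ρ(x) x}` to first order. -/
lemma ae_eq_of_gradient {D : Set Space} (hD : InPlane D ∨ D.Countable) {ρ : Sph → ℝ} {L : ℝ≥0}
    (hlip : LipschitzWith L (radialGauge ρ)) (hρ : ∀ x, 0 < ρ x) :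
    ∀ᵐ x : Sph ∂surf, ∀ d₁ d₂ : ℝ, 0 < d₁ → 0 < d₂ → ∀ P₁ ∈ D, ∀ P₂ ∈ D,
      ρ x = polarRadius d₁ P₁ x → ρ x = polarRadius d₂ P₂ x →
      fderiv ℝ (radialGauge ρ) x = innerSL ℝ (d₁⁻¹ • ((x : Space) - eccVec d₁ P₁)) →
      fderiv ℝ (radialGauge ρ) x = innerSL ℝ (d₂⁻¹ • ((x : Space) - eccVec d₂ P₂)) → P₁ = P₂ := by
  have hinj : ∀ v w : Space, innerSL ℝ v = innerSL ℝ w → v = w := fun v w h =>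
    ext_inner_right ℝ fun u => by simpa using DFunLike.congr_fun h u
  rcases hD with ⟨n, hn, c, hc⟩ | hD
  -- Planar case: distinct foci put `ρ(x) x` in the plane, so almost everywhere `n = c g`. With `2 n
  -- · g = c |g|²` this forces `c = 0`, hence `n · x = 0`, a null great circle.
  · have hV : (innerSL ℝ n).toLinearMap.ker ≠ ⊤ := by
      intro h
      have : n ∈ (innerSL ℝ n).toLinearMap.ker := by rw [h]; trivial
      simp [hn] at this
    filter_upwards [ae_eq_smul_fderiv_radialGauge hlip n c, ae_sph_notMem_submodule hV]
      with x hx hnx d₁ d₂ h₁ h₂ P₁ hP₁ P₂ hP₂ hρ₁ hρ₂ hg₁ hg₂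
    rcases eq_or_mem_span_of_gradient h₁ h₂ rfl (hinj _ _ (hg₁.symm.trans hg₂))
      (hρ₁.symm.trans hρ₂) with h | ⟨-, h⟩
    · exact h
    exfalso
    obtain ⟨h3, h4⟩ := h n c (hc P₁ hP₁) (hc P₂ hP₂)
    have hρx := hρ x
    rw [← hρ₁] at h3
    have h5 := hx (by rw [eq_div_iff hρx.ne', h3])
    rw [hg₁, ← map_smul] at h5
    rw [hinj _ _ h5] at h4
    set g := d₁⁻¹ • ((x : Space) - eccVec d₁ P₁) with hg
    obtain ⟨-, -, h6⟩ := focus_eq_of_gradient h₁ hg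
    have hg0 : g ≠ 0 := by
      intro h0
      rw [h0] at h6
      simp at h6
    have hG : 0 < ‖g‖ ^ 2 := by have := norm_pos_iff.2 hg0; positivity
    rw [real_inner_smul_left, real_inner_self_eq_norm_sq] at h4
    have hc0 : c = 0 := by
      apply mul_right_cancel₀ hG.ne'
      linear_combination h4
    apply hnx
    rw [hc0] at h3
    simpa [hρx.ne'] using h3
  -- Countable case: there are countably many pairs of foci, each spanning a proper subspace.
  · have : ∀ᵐ x : Sph ∂surf, ∀ P₁ ∈ D, ∀ P₂ ∈ D,
        (x : Space) ∉ Submodule.span ℝ {P₁, P₂} := by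
      rw [ae_ball_iff hD]
      intro P₁ _
      rw [ae_ball_iff hD]
      intro P₂ _
      refine ae_sph_notMem_submodule fun h => ?_
      classical
      have h1 := finrank_span_finset_le_card (R := ℝ) ({P₁, P₂} : Finset Space)
      rw [Finset.coe_pair, Set.finrank, h, finrank_top, finrank_euclideanSpace_fin] at h1
      have h2 := Finset.card_le_two (a := P₁) (b := P₂)
      omega
    filter_upwards [this] with x hx d₁ d₂ h₁ h₂ P₁ hP₁ P₂ hP₂ hρ₁ hρ₂ hg₁ hg₂
    rcases eq_or_mem_span_of_gradient h₁ h₂ rfl (hinj _ _ (hg₁.symm.trans hg₂))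
      (hρ₁.symm.trans hρ₂) with h | ⟨h, -⟩
    · exact h
    · exact absurd h (hx P₁ hP₁ P₂ hP₂)

/-! ### Admissible radial functions and the almost everywhere defined reflector map -/

/-- Radial functions, given on the whole sphere, with a Lipschitz gauge, bounds, and at every
point of `closure Ω` a supporting ellipsoid with parameters in a fixed compact set. -/
structure IsAdmissible (Ω : Set Sph) (D : Set Space) (a r R : ℝ) (ρ : Sph → ℝ) : Prop where
  lipschitz : LipschitzWith (2 / a).toNNReal (radialGauge ρ)
  mem_Icc : ∀ x, ρ x ∈ Icc r R
  exists_supports : ∀ x ∈ closure Ω, ∃ z ∈ Icc a (2 * R) ×ˢ D, Supports Ω ρ z.1 z.2 x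

variable {Ω : Set Sph} {D : Set Space} {a r R : ℝ} {ρ : Sph → ℝ}

lemma IsAdmissible.pos (h : IsAdmissible Ω D a r R ρ) (hr : 0 < r) (x : Sph) : 0 < ρ x :=
  hr.trans_le (h.mem_Icc x).1

lemma IsAdmissible.continuous (h : IsAdmissible Ω D a r R ρ) (hr : 0 < r) : Continuous ρ := by
  have h1 : ρ = fun x : Sph => (radialGauge ρ x)⁻¹ := by
    ext x
    rw [radialGauge_sph, one_div, inv_inv]
  have h2 : Continuous fun x : Sph => radialGauge ρ x :=
    h.lipschitz.continuous.comp continuous_subtype_val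
  rw [h1]
  refine h2.inv₀ fun x => ?_
  rw [radialGauge_sph]
  exact one_div_ne_zero (h.pos hr x).ne'

lemma supports_of_tendsto {ρs : ℕ → Sph → ℝ} {zs : ℕ → ℝ × Space} {xs : ℕ → Sph}
    {z : ℝ × Space} {x : Sph}
    (hρ : ∀ y ∈ closure Ω, Tendsto (fun n => ρs n y) atTop (𝓝 (ρ y)))
    (hρx : Tendsto (fun n => ρs n (xs n)) atTop (𝓝 (ρ x)))
    (hz : Tendsto zs atTop (𝓝 z)) (hx : Tendsto xs atTop (𝓝 x)) (hz0 : 0 < z.1)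
    (hS : ∀ n, Supports Ω (ρs n) (zs n).1 (zs n).2 (xs n)) : Supports Ω ρ z.1 z.2 x := by
  refine ⟨hz0, fun y hy => ?_, ?_⟩
  · exact le_of_tendsto_of_tendsto' (hρ y hy)
      ((continuousAt_polarRadius_left hz0 y).tendsto.comp hz) fun n => (hS n).2.1 y hy
  · have h1 : Tendsto (fun n => polarRadius (zs n).1 (zs n).2 (xs n)) atTop
        (𝓝 (polarRadius z.1 z.2 x)) :=
      (continuousAt_polarRadius (w := (z, x)) hz0).tendsto.comp (hz.prodMk_nhds hx)
    exact tendsto_nhds_unique hρx (h1.congr fun n => ((hS n).2.2).symm)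

open Classical in
/-- The parameters `(d, P)`, `P ∈ D`, of some ellipsoid supporting the surface at `ρ(x) x`. -/
noncomputable def supportPair (Ω : Set Sph) (D : Set Space) (ρ : Sph → ℝ) (x : Sph) : ℝ × Space :=
  if h : ∃ z : ℝ × Space, z.2 ∈ D ∧ Supports Ω ρ z.1 z.2 x then h.choose else 0

/-- At `x` the surface has a unique supporting ellipsoid, with parameters `z` in the compact set
`[a, 2R] × D`, and a tangent plane. -/
structure IsRegularAt (Ω : Set Sph) (D : Set Space) (a R : ℝ) (ρ : Sph → ℝ) (x : Sph)
    (z : ℝ × Space) : Prop where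
  mem_closure : x ∈ closure Ω
  mem : z ∈ Icc a (2 * R) ×ˢ D
  supports : Supports Ω ρ z.1 z.2 x
  unique : ∀ w : ℝ × Space, w.2 ∈ D → Supports Ω ρ w.1 w.2 x → w = z
  hasNormal : HasNormal ρ x
  irradiance_eq : ∀ f : Sph → ℝ, irradiance f ρ x = f x * ellDensity z.1 z.2 x

/-- As `frontier Ω` is null, almost every point of `closure Ω` is interior to it. All supporting
ellipsoids there share the same first-order data, hence the same focus, and then the same `d`
because the radius is strictly monotone in `d`. -/
lemma IsAdmissible.ae_isRegularAt (h : IsAdmissible Ω D a r R ρ) (hr : 0 < r)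
    (hD : InPlane D ∨ D.Countable) (hΩ : surf (frontier Ω) = 0) :
    ∀ᵐ x ∂(surf.restrict (closure Ω)), IsRegularAt Ω D a R ρ x (supportPair Ω D ρ x) := by
  have hpos := h.pos hr
  have hfr : ∀ᵐ x ∂surf, x ∉ frontier Ω := measure_eq_zero_iff_ae_notMem.1 hΩ
  filter_upwards [ae_restrict_of_ae hfr, ae_restrict_mem isClosed_closure.measurableSet,
    ae_restrict_of_ae (ae_differentiableAt_radialGauge h.lipschitz),
    ae_restrict_of_ae (ae_eq_of_gradient hD h.lipschitz hpos)] with x hxf hxK hdiff huniq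
  have hxi : x ∈ interior (closure Ω) := by
    by_contra hx
    exact hxf ⟨hxK, fun hx' => hx (interior_mono subset_closure hx')⟩
  have huniq' : ∀ w z : ℝ × Space, w.2 ∈ D → z.2 ∈ D → Supports Ω ρ w.1 w.2 x →
      Supports Ω ρ z.1 z.2 x → w = z := by
    rintro ⟨d₁, P₁⟩ ⟨d₂, P₂⟩ hw hz hSw hSz
    have hP : P₁ = P₂ := huniq d₁ d₂ hSw.1 hSz.1 P₁ hw P₂ hz hSw.2.2 hSz.2.2
      (fderiv_radialGauge_of_supports hpos hxi hSw hdiff.hasFDerivAt)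
      (fderiv_radialGauge_of_supports hpos hxi hSz hdiff.hasFDerivAt)
    subst hP
    exact Prod.ext (polarRadius_injective hSw.1 hSz.1 (hSw.2.2.symm.trans hSz.2.2)) rfl
  obtain ⟨z, hz, hSz⟩ := h.exists_supports x hxK
  have hex : ∃ z : ℝ × Space, z.2 ∈ D ∧ Supports Ω ρ z.1 z.2 x := ⟨z, hz.2, hSz⟩
  have hsp : supportPair Ω D ρ x = hex.choose := dif_pos hex
  have hspz : supportPair Ω D ρ x = z := by
    rw [hsp]
    exact huniq' _ _ hex.choose_spec.1 hz.2 hex.choose_spec.2 hSz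
  rw [hspz]
  exact
    { mem_closure := hxK
      mem := hz
      supports := hSz
      unique := fun w hw hSw => huniq' w z hw hz.2 hSw hSz
      hasNormal := (hasFDerivAt_levelFn (hpos x) hdiff.hasFDerivAt).differentiableAt
      irradiance_eq := irradiance_eq_of_supports hpos hxi hdiff hSz }

lemma IsRegularAt.reflectorMap_eq {x : Sph} {z : ℝ × Space} (h : IsRegularAt Ω D a R ρ x z) :
    reflectorMap Ω D ρ x = {z.2} := by
  ext P
  constructor
  · rintro ⟨hP, d, hS⟩
    exact congrArg Prod.snd (h.unique (d, P) hP hS)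
  · rintro rfl
    exact ⟨h.mem.2, z.1, h.supports⟩

lemma IsAdmissible.isClosed_setOf_supports (h : IsAdmissible Ω D a r R ρ) (ha : 0 < a) (hr : 0 < r)
    (hDc : IsCompact D) {C : Set (ℝ × Space)} (hC : IsClosed C) :
    IsClosed {x | x ∈ closure Ω ∧ ∃ z ∈ (Icc a (2 * R) ×ˢ D) ∩ C, Supports Ω ρ z.1 z.2 x} := by
  refine IsSeqClosed.isClosed fun xs x hxs hx => ?_
  choose hxK zs hzs hSz using hxs
  have hcomp : IsCompact ((Icc a (2 * R) ×ˢ D) ∩ C) := (isCompact_Icc.prod hDc).inter_right hC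
  obtain ⟨z, hz, φ, hφ, hzφ⟩ := hcomp.tendsto_subseq hzs
  refine ⟨isClosed_closure.mem_of_tendsto hx (Eventually.of_forall hxK), z, hz, ?_⟩
  exact supports_of_tendsto (ρs := fun _ => ρ) (fun y _ => tendsto_const_nhds)
    (((h.continuous hr).tendsto x).comp (hx.comp hφ.tendsto_atTop)) hzφ
    (hx.comp hφ.tendsto_atTop) (ha.trans_le hz.1.1.1) fun n => hSz (φ n)

/-- The arbitrary choice in `supportPair` matters only on a null set. Elsewhere, the preimage of a
closed `C` agrees with the set of points supported by some pair in `C`, which is closed by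
compactness. -/
lemma IsAdmissible.aemeasurable_supportPair (h : IsAdmissible Ω D a r R ρ) (ha : 0 < a)
    (hr : 0 < r) (hDc : IsCompact D) (hD : InPlane D ∨ D.Countable)
    (hΩ : surf (frontier Ω) = 0) :
    AEMeasurable (supportPair Ω D ρ) (surf.restrict (closure Ω)) := by
  have hC : ∀ C : Set (ℝ × Space), IsClosed C →
      NullMeasurableSet (supportPair Ω D ρ ⁻¹' C) (surf.restrict (closure Ω)) := by
    intro C hC
    refine NullMeasurableSet.congr
      (h.isClosed_setOf_supports ha hr hDc hC).measurableSet.nullMeasurableSet ?_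
    rw [eventuallyEq_set]
    filter_upwards [h.ae_isRegularAt hr hD hΩ] with x hx
    constructor
    · rintro ⟨-, z, hz, hS⟩
      have := hx.unique z hz.1.2 hS
      rw [mem_preimage, ← this]
      exact hz.2
    · intro hxC
      exact ⟨hx.mem_closure, _, ⟨hx.mem, hxC⟩, hx.supports⟩
  have hm : @Measurable (NullMeasurableSpace Sph (surf.restrict (closure Ω))) (ℝ × Space) _ _
      (supportPair Ω D ρ) := measurable_of_isClosed hC
  exact NullMeasurable.aemeasurable hm

lemma measurable_ellDensity :
    Measurable fun w : (ℝ × Space) × Sph => ellDensity w.1.1 w.1.2 w.2 := by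
  have h1 : Measurable fun w : (ℝ × Space) × Sph => eccVec w.1.1 w.1.2 := by
    unfold eccVec
    exact (continuous_majorAxis.measurable.inv.smul measurable_snd).comp measurable_fst
  have h2 : Measurable fun w : (ℝ × Space) × Sph => (w.2 : Space) :=
    measurable_subtype_coe.comp measurable_snd
  unfold ellDensity
  exact ((measurable_const.sub (h2.inner h1)).pow_const 3).div
    (((measurable_fst.comp measurable_fst).pow_const 2).mul (h2.sub h1).norm)

variable {f : Sph → ℝ}

lemma IsAdmissible.aestronglyMeasurable_irradiance (h : IsAdmissible Ω D a r R ρ) (ha : 0 < a)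
    (hr : 0 < r) (hDc : IsCompact D) (hD : InPlane D ∨ D.Countable)
    (hΩ : surf (frontier Ω) = 0) (hf : IntegrableOn f (closure Ω) surf) :
    AEStronglyMeasurable (irradiance f ρ) (surf.restrict (closure Ω)) := by
  have h1 : AEStronglyMeasurable (fun x => f x *
      ellDensity (supportPair Ω D ρ x).1 (supportPair Ω D ρ x).2 x)
      (surf.restrict (closure Ω)) :=
    hf.aestronglyMeasurable.mul (measurable_ellDensity.comp_aemeasurable
      ((h.aemeasurable_supportPair ha hr hDc hD hΩ).prodMk
        aemeasurable_id)).aestronglyMeasurable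
  refine h1.congr ?_
  filter_upwards [h.ae_isRegularAt hr hD hΩ] with x hx
  exact (hx.irradiance_eq f).symm

lemma IsRegularAt.abs_irradiance_le {x : Sph} {z : ℝ × Space} (h : IsRegularAt Ω D a R ρ x z)
    (ha : 0 < a) : |irradiance f ρ x| ≤ 4 / a ^ 2 * |f x| := by
  have hz := h.mem.1.1
  rw [h.irradiance_eq, abs_mul, abs_of_nonneg (ellDensity_nonneg (ha.trans_le hz) _ _), mul_comm]
  gcongr
  exact ellDensity_le ha hz _ _

lemma IsAdmissible.integrableOn_irradiance (h : IsAdmissible Ω D a r R ρ) (ha : 0 < a)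
    (hr : 0 < r) (hDc : IsCompact D) (hD : InPlane D ∨ D.Countable)
    (hΩ : surf (frontier Ω) = 0) (hf : IntegrableOn f (closure Ω) surf) :
    IntegrableOn (irradiance f ρ) (closure Ω) surf := by
  refine Integrable.mono' (hf.abs.const_mul (4 / a ^ 2))
    (h.aestronglyMeasurable_irradiance ha hr hDc hD hΩ hf) ?_
  filter_upwards [h.ae_isRegularAt hr hD hΩ] with x hx
  exact hx.abs_irradiance_le ha

/-- The integral of `φ` against the illumination that the reflector produces on `D`. -/
noncomputable def illumination (Ω : Set Sph) (D : Set Space) (f ρ : Sph → ℝ) (φ : Space → ℝ) : ℝ :=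
  ∫ x in closure Ω, φ (supportPair Ω D ρ x).2 * irradiance f ρ x ∂surf

lemma IsAdmissible.integrable_illumination (h : IsAdmissible Ω D a r R ρ) (ha : 0 < a)
    (hr : 0 < r) (hDc : IsCompact D) (hD : InPlane D ∨ D.Countable)
    (hΩ : surf (frontier Ω) = 0) (hf : IntegrableOn f (closure Ω) surf)
    {φ : Space → ℝ} (hφ : Continuous φ) :
    Integrable (fun x => φ (supportPair Ω D ρ x).2 * irradiance f ρ x)
      (surf.restrict (closure Ω)) := by
  obtain ⟨C, hC⟩ := hDc.exists_bound_of_continuousOn hφ.continuousOn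
  refine Integrable.bdd_mul (c := C) (h.integrableOn_irradiance ha hr hDc hD hΩ hf)
    (hφ.measurable.comp_aemeasurable
      (h.aemeasurable_supportPair ha hr hDc hD hΩ).snd).aestronglyMeasurable ?_
  filter_upwards [h.ae_isRegularAt hr hD hΩ] with x hx
  exact hC _ hx.mem.2

/-- Where all the surfaces are regular, every cluster point of the supporting pairs supports the
limit surface, so by uniqueness the pairs converge. The integrands are continuous in the pair and
dominated by a multiple of `|f|`. -/
lemma tendsto_illumination (ha : 0 < a) (hr : 0 < r) (hDc : IsCompact D)
    (hD : InPlane D ∨ D.Countable) (hΩ : surf (frontier Ω) = 0)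
    (hf : IntegrableOn f (closure Ω) surf) {ρs : ℕ → Sph → ℝ}
    (hρs : ∀ n, IsAdmissible Ω D a r R (ρs n)) (hρ : IsAdmissible Ω D a r R ρ)
    (hlim : ∀ x, Tendsto (fun n => ρs n x) atTop (𝓝 (ρ x)))
    {φ : Space → ℝ} (hφ : Continuous φ) :
    Tendsto (fun n => illumination Ω D f (ρs n) φ) atTop (𝓝 (illumination Ω D f ρ φ)) := by
  obtain ⟨C, hC⟩ := hDc.exists_bound_of_continuousOn hφ.continuousOn
  have hreg : ∀ᵐ x ∂(surf.restrict (closure Ω)), ∀ n,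
      IsRegularAt Ω D a R (ρs n) x (supportPair Ω D (ρs n) x) :=
    ae_all_iff.2 fun n => (hρs n).ae_isRegularAt hr hD hΩ
  refine tendsto_integral_of_dominated_convergence (fun x => C * (4 / a ^ 2 * |f x|))
    (fun n => ((hρs n).integrable_illumination ha hr hDc hD hΩ hf hφ).aestronglyMeasurable)
    ((hf.abs.const_mul _).const_mul _) (fun n => ?_) ?_
  · filter_upwards [hreg] with x hx
    rw [norm_mul, Real.norm_eq_abs (irradiance _ _ _)]
    have h1 := hC _ (hx n).mem.2
    have h2 := (hx n).abs_irradiance_le (f := f) ha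
    exact mul_le_mul h1 h2 (abs_nonneg _) ((norm_nonneg _).trans h1)
  · filter_upwards [hreg, hρ.ae_isRegularAt hr hD hΩ] with x hxs hx
    have hz : Tendsto (fun n => supportPair Ω D (ρs n) x) atTop (𝓝 (supportPair Ω D ρ x)) := by
      refine (isCompact_Icc.prod hDc).tendsto_nhds_of_unique_mapClusterPt
        (Eventually.of_forall fun n => (hxs n).mem) fun z hz hzc => ?_
      obtain ⟨ψ, hψ, hzψ⟩ := hzc.tendsto_subseq
      refine hx.unique z hz.2 (supports_of_tendsto (ρs := fun n => ρs (ψ n)) (xs := fun _ => x)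
        (fun y _ => (hlim y).comp hψ.tendsto_atTop) ((hlim x).comp hψ.tendsto_atTop) hzψ
        tendsto_const_nhds (ha.trans_le hz.1.1) fun n => (hxs (ψ n)).supports)
    have h1 : Tendsto (fun n => ellDensity (supportPair Ω D (ρs n) x).1
        (supportPair Ω D (ρs n) x).2 x) atTop
        (𝓝 (ellDensity (supportPair Ω D ρ x).1 (supportPair Ω D ρ x).2 x)) :=
      (continuousAt_ellDensity_left (ha.trans_le hx.mem.1.1) x).tendsto.comp hz
    have h2 : Tendsto (fun n => φ (supportPair Ω D (ρs n) x).2) atTop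
        (𝓝 (φ (supportPair Ω D ρ x).2)) :=
      (hφ.tendsto _).comp ((continuous_snd.tendsto _).comp hz)
    simp only [(hxs _).irradiance_eq, hx.irradiance_eq]
    exact h2.mul (h1.const_mul _)

/-! ### Reflectors made of finitely many ellipsoids -/

/-- The hypotheses on the source, the target and the constants. Here `a` bounds the parameters
`d` from below and `c` bounds the eccentricities from above. -/
structure IsSetting (Ω : Set Sph) (D : Set Space) (f : Sph → ℝ) (a c k : ℝ) : Prop where
  isCompact : IsCompact D
  inPlane_or_countable : InPlane D ∨ D.Countable
  frontier_null : surf (frontier Ω) = 0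
  integrableOn : IntegrableOn f (closure Ω) surf
  ae_pos : ∀ᵐ x ∂(surf.restrict (closure Ω)), 0 < f x
  a_pos : 0 < a
  c_nonneg : 0 ≤ c
  c_lt_one : c < 1
  norm_eccVec_le : ∀ P ∈ D, ∀ d, a ≤ d → ‖eccVec d P‖ ≤ c
  le_k : (1 + c) / (1 - c) ≤ k

section

variable {Ω : Set Sph} {D : Set Space} {f : Sph → ℝ} {a c k : ℝ}

lemma IsSetting.one_le_k (h : IsSetting Ω D f a c k) : 1 ≤ k := by
  have h1 := h.c_lt_one
  have h2 := h.c_nonneg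
  refine le_trans ?_ h.le_k
  rw [one_le_div (by linarith)]
  linarith

lemma IsSetting.lower_pos (h : IsSetting Ω D f a c k) : 0 < a / (1 + c) := by
  have h1 := h.a_pos
  have h2 := h.c_nonneg
  positivity

lemma IsSetting.a_le (h : IsSetting Ω D f a c k) : a ≤ k * a := by
  have h1 := h.a_pos
  have h2 := h.one_le_k
  nlinarith

lemma IsSetting.ka_le_upper (h : IsSetting Ω D f a c k) : k * a ≤ k * a / (1 - c) := by
  have h1 := h.a_pos.trans_le h.a_le
  have h2 := h.c_nonneg
  have h3 := h.c_lt_one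
  rw [le_div_iff₀ (by linarith)]
  nlinarith

variable {ι : Type*}

/-- The parameters allowed for the ellipsoids: the one at `i₀` is `k a`, the others are at
least `a`. -/
def paramBox (a c k : ℝ) (i₀ : ι) : Set (ι → ℝ) :=
  Icc (fun _ => a) (fun _ => 2 * (k * a / (1 - c)) + 1) ∩ {b | b i₀ = k * a}

lemma isCompact_paramBox (a c k : ℝ) (i₀ : ι) : IsCompact (paramBox a c k i₀) :=
  isCompact_Icc.inter_right (isClosed_eq (continuous_apply i₀) continuous_const)

variable [Fintype ι]

/-- A continuous function equal to `1` at `P i` and to `0` at the other points `P j`. -/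
noncomputable def bump [DecidableEq ι] (P : ι → Space) (i : ι) (y : Space) : ℝ :=
  ∏ j ∈ Finset.univ.erase i, dist y (P j) / dist (P i) (P j)

lemma continuous_bump [DecidableEq ι] (P : ι → Space) (i : ι) : Continuous (bump P i) := by
  unfold bump
  fun_prop

lemma bump_apply [DecidableEq ι] (hP : Function.Injective P) (i j : ι) :
    bump P i (P j) = if i = j then 1 else 0 := by
  unfold bump
  split_ifs with hij
  · subst hij
    refine Finset.prod_eq_one fun l hl => div_self ?_
    rw [dist_ne_zero]
    exact fun h => (Finset.ne_of_mem_erase hl) (hP h).symm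
  · refine Finset.prod_eq_zero (Finset.mem_erase.2 ⟨Ne.symm hij, Finset.mem_univ j⟩) ?_
    simp

variable [Nonempty ι]

/-- The radial function of the intersection of the ellipsoids `E_{b i}(P i)`. -/
noncomputable def minRadius (P : ι → Space) (b : ι → ℝ) (x : Sph) : ℝ :=
  Finset.univ.inf' Finset.univ_nonempty fun i => polarRadius (b i) (P i) x

variable {P : ι → Space} {b : ι → ℝ}

lemma minRadius_le (i : ι) (x : Sph) : minRadius P b x ≤ polarRadius (b i) (P i) x :=
  Finset.inf'_le _ (Finset.mem_univ i)

lemma exists_minRadius_eq (P : ι → Space) (b : ι → ℝ) (x : Sph) :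
    ∃ i, minRadius P b x = polarRadius (b i) (P i) x := by
  obtain ⟨i, -, hi⟩ := Finset.exists_mem_eq_inf' Finset.univ_nonempty
    fun i => polarRadius (b i) (P i) x
  exact ⟨i, hi⟩

lemma supports_minRadius {i : ι} {x : Sph} (hb : 0 < b i)
    (h : polarRadius (b i) (P i) x ≤ minRadius P b x) :
    Supports Ω (minRadius P b) (b i) (P i) x :=
  ⟨hb, fun _ _ => minRadius_le i _, le_antisymm (minRadius_le i x) h⟩

lemma minRadius_mono {b' : ι → ℝ} (hb' : ∀ i, 0 < b' i) (h : b' ≤ b) (x : Sph) :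
    minRadius P b' x ≤ minRadius P b x :=
  Finset.le_inf' _ _ fun i _ => (minRadius_le i x).trans (polarRadius_mono (hb' i) (h i) _ _)

lemma tendsto_minRadius {bs : ℕ → ι → ℝ} (hb : ∀ i, 0 < b i) (h : Tendsto bs atTop (𝓝 b))
    (x : Sph) : Tendsto (fun n => minRadius P (bs n) x) atTop (𝓝 (minRadius P b x)) := by
  refine Tendsto.finset_inf'_nhds_apply Finset.univ_nonempty fun i _ => ?_
  have h1 : Tendsto (fun n => (bs n i, P i)) atTop (𝓝 (b i, P i)) :=
    ((tendsto_pi_nhds.1 h) i).prodMk_nhds tendsto_const_nhds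
  exact (continuousAt_polarRadius_left (z := (b i, P i)) (hb i) x).tendsto.comp h1

/-- The gauge of an intersection is the maximum of the gauges, and a maximum keeps a common
Lipschitz constant. -/
lemma lipschitzWith_radialGauge_minRadius (ha : 0 < a) (hb : ∀ i, a ≤ b i) :
    LipschitzWith (2 / a).toNNReal (radialGauge (minRadius P b)) := by
  have hpos : ∀ x, 0 < minRadius P b x := fun x => by
    obtain ⟨i, hi⟩ := exists_minRadius_eq P b x
    rw [hi]
    exact polarRadius_pos (ha.trans_le (hb i)) _ _
  have hle : ∀ i y, radialGauge (polarRadius (b i) (P i)) y ≤ radialGauge (minRadius P b) y := by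
    intro i y
    rcases eq_or_ne y 0 with rfl | hy
    · simp [radialGauge_zero]
    · exact radialGauge_anti hy (hpos _) (minRadius_le i _)
  have heq : ∀ x, ∃ i, radialGauge (minRadius P b) x = radialGauge (polarRadius (b i) (P i)) x := by
    intro x
    rcases eq_or_ne x 0 with rfl | hx
    · exact ⟨Classical.arbitrary ι, by simp [radialGauge_zero]⟩
    · obtain ⟨i, hi⟩ := exists_minRadius_eq P b (direction x hx)
      exact ⟨i, by rw [radialGauge_of_ne _ hx, radialGauge_of_ne _ hx, hi]⟩
  refine LipschitzWith.of_le_add_mul _ fun x y => ?_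
  obtain ⟨i, hi⟩ := heq x
  have h1 := (lipschitzWith_radialGauge_polarRadius ha (hb i) (P i)).le_add_mul x y
  have h2 := hle i y
  rw [hi]
  linarith

variable {i₀ : ι}

lemma IsSetting.isAdmissible_minRadius (h : IsSetting Ω D f a c k) (hP : ∀ i, P i ∈ D)
    (hb : b ∈ paramBox a c k i₀) :
    IsAdmissible Ω D a (a / (1 + c)) (k * a / (1 - c)) (minRadius P b) := by
  have hba : ∀ i, a ≤ b i := hb.1.1
  have hb0 : ∀ i, 0 < b i := fun i => h.a_pos.trans_le (hba i)
  have hecc : ∀ i, ‖eccVec (b i) (P i)‖ ≤ c := fun i => h.norm_eccVec_le _ (hP i) _ (hba i)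
  have hR : ∀ x, minRadius P b x ≤ k * a / (1 - c) := fun x =>
    (minRadius_le i₀ x).trans (by
      have := polarRadius_le (hb0 i₀) (hecc i₀) h.c_lt_one x
      rwa [show b i₀ = k * a from hb.2] at this ⊢)
  refine ⟨lipschitzWith_radialGauge_minRadius h.a_pos hba, fun x => ⟨?_, hR x⟩, fun x _ => ?_⟩
  · obtain ⟨i, hi⟩ := exists_minRadius_eq P b x
    rw [hi]
    refine le_trans ?_ (le_polarRadius (hb0 i) (hecc i) x)
    have := h.c_nonneg
    have := hba i
    gcongr
  · obtain ⟨i, hi⟩ := exists_minRadius_eq P b x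
    refine ⟨(b i, P i), ⟨⟨hba i, ?_⟩, hP i⟩, supports_minRadius (hb0 i) hi.ge⟩
    have h1 := lt_two_mul_polarRadius (hb0 i) (P i) x
    rw [← hi] at h1
    linarith [hR x]

lemma IsSetting.ae_isRegularAt (h : IsSetting Ω D f a c k) {r R : ℝ} (hr : 0 < r) {ρ : Sph → ℝ}
    (hρ : IsAdmissible Ω D a r R ρ) : ∀ᵐ x ∂(surf.restrict (closure Ω)),
      IsRegularAt Ω D a R ρ x (supportPair Ω D ρ x) :=
  hρ.ae_isRegularAt hr h.inPlane_or_countable h.frontier_null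

lemma IsRegularAt.exists_eq_minRadius {R : ℝ} {x : Sph} {z : ℝ × Space} (hP : ∀ i, P i ∈ D)
    (hb : ∀ i, 0 < b i) (h : IsRegularAt Ω D a R (minRadius P b) x z) :
    ∃ i, z = (b i, P i) ∧ minRadius P b x = polarRadius (b i) (P i) x := by
  obtain ⟨i, hi⟩ := exists_minRadius_eq P b x
  exact ⟨i, (h.unique (b i, P i) (hP i) (supports_minRadius (hb i) hi.ge)).symm, hi⟩

variable [DecidableEq ι]

/-- The energy that the reflector `minRadius P b` sends to `P i`. -/
noncomputable def energyAt (Ω : Set Sph) (D : Set Space) (f : Sph → ℝ) (P : ι → Space) (i : ι)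
    (b : ι → ℝ) : ℝ :=
  illumination Ω D f (minRadius P b) (bump P i)

lemma IsSetting.illumination_minRadius (h : IsSetting Ω D f a c k) (hP : ∀ i, P i ∈ D)
    (hPi : Function.Injective P) (hb : b ∈ paramBox a c k i₀) (φ : Space → ℝ) :
    illumination Ω D f (minRadius P b) φ = ∑ i, φ (P i) * energyAt Ω D f P i b := by
  have hadm := h.isAdmissible_minRadius hP hb
  have hb0 : ∀ i, 0 < b i := fun i => h.a_pos.trans_le (hb.1.1 i)
  simp only [energyAt, illumination, ← integral_const_mul]
  rw [← integral_finsetSum]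
  · refine integral_congr_ae ?_
    filter_upwards [h.ae_isRegularAt h.lower_pos hadm] with x hx
    obtain ⟨i, hi, -⟩ := hx.exists_eq_minRadius hP hb0
    simp only [hi, bump_apply hPi]
    simp
  · intro i _
    exact (hadm.integrable_illumination h.a_pos h.lower_pos h.isCompact h.inPlane_or_countable
      h.frontier_null h.integrableOn (continuous_bump P i)).const_mul _

/-- Enlarging the other ellipsoids while keeping the `i`-th leaves the `i`-th in contact wherever it
was. Those directions still go to `P i`, with the same irradiance. -/
lemma IsSetting.energyAt_mono (h : IsSetting Ω D f a c k) (hP : ∀ i, P i ∈ D)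
    (hPi : Function.Injective P) {b' : ι → ℝ} (hb : b ∈ paramBox a c k i₀)
    (hb' : b' ∈ paramBox a c k i₀) (hle : b' ≤ b) {i : ι} (hi : b' i = b i) :
    energyAt Ω D f P i b' ≤ energyAt Ω D f P i b := by
  have hadm := h.isAdmissible_minRadius hP hb
  have hadm' := h.isAdmissible_minRadius hP hb'
  have hb0 : ∀ i, 0 < b i := fun i => h.a_pos.trans_le (hb.1.1 i)
  have hb0' : ∀ i, 0 < b' i := fun i => h.a_pos.trans_le (hb'.1.1 i)
  refine integral_mono_ae
    (hadm'.integrable_illumination h.a_pos h.lower_pos h.isCompact h.inPlane_or_countable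
      h.frontier_null h.integrableOn (continuous_bump P i))
    (hadm.integrable_illumination h.a_pos h.lower_pos h.isCompact h.inPlane_or_countable
      h.frontier_null h.integrableOn (continuous_bump P i)) ?_
  filter_upwards [h.ae_isRegularAt h.lower_pos hadm, h.ae_isRegularAt h.lower_pos hadm', h.ae_pos]
    with x hx hx' hfx
  obtain ⟨j', hj', hr'⟩ := hx'.exists_eq_minRadius hP hb0'
  obtain ⟨j, hj, hr⟩ := hx.exists_eq_minRadius hP hb0
  rw [hx.irradiance_eq, hx'.irradiance_eq]
  simp only [hj', hj, bump_apply hPi]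
  have hE := ellDensity_nonneg (hb0 j) (P j) x
  by_cases hij' : i = j'
  · subst hij'
    have hz := hx.unique (b i, P i) (hP i) (supports_minRadius (hb0 i) (by
      rw [← hi, ← hr']
      exact minRadius_mono hb0' hle x))
    rw [hj, Prod.mk.injEq] at hz
    have hij := hPi hz.2
    subst hij
    rw [hi]
  · rw [if_neg hij', zero_mul]
    split_ifs <;> positivity

lemma IsSetting.energyAt_eq_zero (h : IsSetting Ω D f a c k) (hP : ∀ i, P i ∈ D)
    (hPi : Function.Injective P) (hb : b ∈ paramBox a c k i₀) {i : ι}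
    (hi : ∀ x z, IsRegularAt Ω D a (k * a / (1 - c)) (minRadius P b) x z → z ≠ (b i, P i)) :
    energyAt Ω D f P i b = 0 := by
  have hadm := h.isAdmissible_minRadius hP hb
  have hb0 : ∀ i, 0 < b i := fun i => h.a_pos.trans_le (hb.1.1 i)
  refine integral_eq_zero_of_ae ?_
  filter_upwards [h.ae_isRegularAt h.lower_pos hadm] with x hx
  obtain ⟨j, hj, -⟩ := hx.exists_eq_minRadius hP hb0
  have hij : i ≠ j := by
    rintro rfl
    exact hi x _ hx hj
  simp [hj, bump_apply hPi, hij]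

lemma IsSetting.tendsto_energyAt (h : IsSetting Ω D f a c k) (hP : ∀ i, P i ∈ D)
    {bs : ℕ → ι → ℝ} (hbs : ∀ n, bs n ∈ paramBox a c k i₀) (hb : b ∈ paramBox a c k i₀)
    (hlim : Tendsto bs atTop (𝓝 b)) (i : ι) :
    Tendsto (fun n => energyAt Ω D f P i (bs n)) atTop (𝓝 (energyAt Ω D f P i b)) :=
  tendsto_illumination h.a_pos h.lower_pos h.isCompact h.inPlane_or_countable h.frontier_null
    h.integrableOn (fun n => h.isAdmissible_minRadius hP (hbs n)) (h.isAdmissible_minRadius hP hb)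
    (tendsto_minRadius (fun i => h.a_pos.trans_le (hb.1.1 i)) hlim) (continuous_bump P i)

lemma IsSetting.le_integral_irradiance (h : IsSetting Ω D f a c k) {r : ℝ} (hr : 0 < r)
    {ρ : Sph → ℝ} (hρ : IsAdmissible Ω D a r (k * a / (1 - c)) ρ) :
    (1 - c) / (1 + c) / (k * a / (1 - c)) ^ 2 * ∫ x in closure Ω, f x ∂surf ≤
      ∫ x in closure Ω, irradiance f ρ x ∂surf := by
  rw [← integral_const_mul]
  refine integral_mono_ae (h.integrableOn.const_mul _)
    (hρ.integrableOn_irradiance h.a_pos hr h.isCompact h.inPlane_or_countable h.frontier_null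
      h.integrableOn) ?_
  filter_upwards [h.ae_isRegularAt hr hρ, h.ae_pos] with x hx hfx
  rw [hx.irradiance_eq, mul_comm]
  have hz := hx.mem
  refine mul_le_mul_of_nonneg_left (le_ellDensity (h.a_pos.trans_le hz.1.1)
    (h.norm_eccVec_le _ hz.2 _ hz.1.1) h.c_lt_one ?_) hfx.le
  rw [← hx.supports.2.2]
  exact (hρ.mem_Icc x).2

/-- Solution of the problem for finitely many target points. -/
theorem IsSetting.exists_energyAt_eq (h : IsSetting Ω D f a c k) (hP : ∀ i, P i ∈ D)
    (hPi : Function.Injective P) (i₀ : ι) {g : ι → ℝ} (hg : ∀ i, 0 ≤ g i) (hg0 : 0 < g i₀)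
    (hsum : ∑ i, g i ≤
      (1 - c) / (1 + c) / (k * a / (1 - c)) ^ 2 * ∫ x in closure Ω, f x ∂surf) :
    ∃ b ∈ paramBox a c k i₀, (∀ i ≠ i₀, energyAt Ω D f P i b = g i) ∧
      g i₀ ≤ energyAt Ω D f P i₀ b := by
  have ha := h.a_pos
  -- `W` consists of the parameters that do not overfill any target other than `P i₀`; the solution
  -- is a minimiser of `∑ b i` on it.
  set W : Set (ι → ℝ) :=
    {b | b ∈ paramBox a c k i₀ ∧ ∀ i ≠ i₀, energyAt Ω D f P i b ≤ g i} with hW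
  have hWc : IsCompact W := by
    refine (isCompact_paramBox a c k i₀).of_isClosed_subset ?_ fun b hb => hb.1
    refine IsSeqClosed.isClosed fun bs b hbs hlim => ?_
    have hb : b ∈ paramBox a c k i₀ := (isCompact_paramBox a c k i₀).isClosed.mem_of_tendsto hlim
      (Eventually.of_forall fun n => (hbs n).1)
    exact ⟨hb, fun i hi => le_of_tendsto' (h.tendsto_energyAt hP (fun n => (hbs n).1) hb hlim i)
      fun n => (hbs n).2 i hi⟩
  have hWne : W.Nonempty := by
    -- Nonemptiness: a supporting ellipsoid has `d ≤ 2 R`, so with parameter `2 R + 1` the targets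
    -- other than `P i₀` receive nothing.
    have h1 := h.a_le
    have h2 := h.ka_le_upper
    set b : ι → ℝ := Function.update (fun _ => 2 * (k * a / (1 - c)) + 1) i₀ (k * a) with hbdef
    have hb : b ∈ paramBox a c k i₀ := by
      refine ⟨⟨fun i => ?_, fun i => ?_⟩, by simp [hbdef]⟩
      · rcases eq_or_ne i i₀ with rfl | hi
        · simpa [hbdef] using h1
        · simp only [hbdef, Function.update_of_ne hi]
          linarith
      · rcases eq_or_ne i i₀ with rfl | hi
        · simp only [hbdef, Function.update_self]
          linarith
        · simp [hbdef, Function.update_of_ne hi]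
    refine ⟨b, hb, fun i hi => ?_⟩
    rw [h.energyAt_eq_zero hP hPi hb]
    · exact hg i
    · rintro x z hx rfl
      have := hx.mem.1.2
      simp only [hbdef, Function.update_of_ne hi] at this
      linarith
  obtain ⟨b, hb, hmin⟩ := hWc.exists_isMinOn hWne
    (continuous_finsetSum Finset.univ fun i _ => continuous_apply i).continuousOn
  have hbox := hb.1
  have htotal : ∑ i, g i ≤ ∑ i, energyAt Ω D f P i b := by
    have h1 := h.illumination_minRadius hP hPi hbox (fun _ => 1)
    have h2 := h.le_integral_irradiance h.lower_pos (h.isAdmissible_minRadius hP hbox)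
    simp only [illumination, one_mul] at h1
    rw [← h1]
    exact hsum.trans h2
  -- If `b i = a`, then `a / (1 - c) ≤ k a / (1 + c)` places `E_a(P i)` inside `E_{ka}(P i₀)`. So `P
  -- i₀` receives no energy, and since `g i₀ > 0` the total falls short of `∑ g i`.
  have hgt : ∀ i ≠ i₀, a < b i := by
    intro i hi
    refine lt_of_le_of_ne (hbox.1.1 i) fun hbi => ?_
    have hzero : energyAt Ω D f P i₀ b = 0 := by
      refine h.energyAt_eq_zero hP hPi hbox ?_
      rintro x z hx rfl
      have h1 := h.c_nonneg
      have h2 := h.c_lt_one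
      have hle : polarRadius (b i) (P i) x ≤ polarRadius (b i₀) (P i₀) x := by
        have h3 : b i₀ = k * a := hbox.2
        have h4 := polarRadius_le ha (h.norm_eccVec_le _ (hP i) a le_rfl) h2 x
        have h5 := le_polarRadius (ha.trans_le h.a_le)
          (h.norm_eccVec_le _ (hP i₀) (k * a) h.a_le) x
        rw [← hbi, h3]
        refine h4.trans (le_trans ?_ h5)
        have h6 := h.le_k
        rw [div_le_iff₀ (by linarith)] at h6
        rw [div_le_div_iff₀ (by linarith) (by linarith)]
        nlinarith
      have := hx.unique (b i, P i) (hP i) (supports_minRadius (hbi ▸ ha)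
        (hle.trans hx.supports.2.2.ge))
      exact hi (hPi (congrArg Prod.snd this))
    have h1 : ∑ i, energyAt Ω D f P i b = ∑ i ∈ Finset.univ.erase i₀, energyAt Ω D f P i b := by
      rw [← Finset.add_sum_erase _ _ (Finset.mem_univ i₀), hzero, zero_add]
    have h2 : ∑ i ∈ Finset.univ.erase i₀, energyAt Ω D f P i b ≤ ∑ i ∈ Finset.univ.erase i₀, g i :=
      Finset.sum_le_sum fun i hi => hb.2 i (Finset.ne_of_mem_erase hi)
    have h3 := Finset.add_sum_erase _ g (Finset.mem_univ i₀)
    linarith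
  have heq : ∀ i ≠ i₀, energyAt Ω D f P i b = g i := by
    intro i hi
    by_contra hne
    have hlt := lt_of_le_of_ne (hb.2 i hi) hne
    -- Lower `b i` slightly towards `a`. By continuity the energy at `P i` stays below `g i`, the
    -- energies of the other targets outside `i₀` do not grow, and `∑ b j` drops, contradicting
    -- minimality.
    set bs : ℕ → ι → ℝ := fun n => Function.update b i (b i - (b i - a) * (1 / ((n : ℝ) + 1)))
    have hn : ∀ n : ℕ, 0 < 1 / ((n : ℝ) + 1) ∧ 1 / ((n : ℝ) + 1) ≤ 1 := fun n =>
      ⟨by positivity, by rw [div_le_one (by positivity)]; linarith [(n.cast_nonneg : (0 : ℝ) ≤ n)]⟩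
    have hai := hgt i hi
    have hbsle : ∀ n, bs n ≤ b := by
      intro n j
      rcases eq_or_ne j i with rfl | hj
      · simp only [bs, Function.update_self]
        nlinarith [(hn n).1]
      · simp [bs, Function.update_of_ne hj]
    have hbs : ∀ n, bs n ∈ paramBox a c k i₀ := by
      intro n
      refine ⟨⟨fun j => ?_, (hbsle n).trans hbox.1.2⟩, ?_⟩
      · rcases eq_or_ne j i with rfl | hj
        · simp only [bs, Function.update_self]
          nlinarith [(hn n).2]
        · simpa [bs, Function.update_of_ne hj] using hbox.1.1 j
      · simpa [bs, Function.update_of_ne hi.symm] using hbox.2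
    have hlim : Tendsto bs atTop (𝓝 b) := by
      have h1 : Tendsto (fun n : ℕ => b i - (b i - a) * (1 / ((n : ℝ) + 1))) atTop (𝓝 (b i)) := by
        simpa using (tendsto_one_div_add_atTop_nhds_zero_nat (𝕜 := ℝ)).const_mul (b i - a)
          |>.const_sub (b i)
      simpa [bs] using (tendsto_const_nhds (x := b)).update i h1
    obtain ⟨n, hn'⟩ := ((h.tendsto_energyAt hP hbs hbox hlim i).eventually_lt_const hlt).exists
    have hnW : bs n ∈ W := by
      refine ⟨hbs n, fun j hj => ?_⟩
      rcases eq_or_ne j i with rfl | hji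
      · exact hn'.le
      · exact (h.energyAt_mono hP hPi hbox (hbs n) (hbsle n)
          (by simp [bs, Function.update_of_ne hji])).trans (hb.2 j hj)
    have h1 := hmin hnW
    have h2 : ∑ j, bs n j < ∑ j, b j := by
      refine Finset.sum_lt_sum (fun j _ => hbsle n j) ⟨i, Finset.mem_univ i, ?_⟩
      simp only [bs, Function.update_self]
      nlinarith [(hn n).1]
    exact absurd h1 (not_le.2 h2)
  refine ⟨b, hbox, heq, ?_⟩
  have h1 := Finset.add_sum_erase _ g (Finset.mem_univ i₀)
  have h2 := Finset.add_sum_erase _ (fun i => energyAt Ω D f P i b) (Finset.mem_univ i₀)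
  have h3 : ∑ i ∈ Finset.univ.erase i₀, energyAt Ω D f P i b = ∑ i ∈ Finset.univ.erase i₀, g i :=
    Finset.sum_congr rfl fun i hi => heq i (Finset.ne_of_mem_erase hi)
  linarith

end

/-- The problem for a finitely supported target distribution, in terms of test functions. -/
theorem IsSetting.exists_illumination_eq_sum {Ω : Set Sph} {D : Set Space} {f : Sph → ℝ}
    {a c k : ℝ} (h : IsSetting Ω D f a c k) {F : Finset Space} (hF : (F : Set Space) ⊆ D)
    {P₀ : Space} (hP₀ : P₀ ∈ F) {g : Space → ℝ} (hg : ∀ P, 0 ≤ g P) (hg0 : 0 < g P₀)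
    (hsum : ∑ P ∈ F, g P ≤
      (1 - c) / (1 + c) / (k * a / (1 - c)) ^ 2 * ∫ x in closure Ω, f x ∂surf) :
    ∃ ρ, IsAdmissible Ω D a (a / (1 + c)) (k * a / (1 - c)) ρ ∧ ∃ e, 0 ≤ e ∧
      ∀ φ : Space → ℝ, illumination Ω D f ρ φ = ∑ P ∈ F, φ P * g P + e * φ P₀ := by
  classical
  have : Nonempty F := ⟨⟨P₀, hP₀⟩⟩
  have hP : ∀ i : F, (i : Space) ∈ D := fun i => hF i.2
  have hPi : Function.Injective fun i : F => (i : Space) := Subtype.val_injective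
  obtain ⟨b, hb, heq, hge⟩ := h.exists_energyAt_eq hP hPi ⟨P₀, hP₀⟩ (g := fun i => g i)
    (fun i => hg i) hg0 (by rwa [Finset.sum_coe_sort F g])
  refine ⟨_, h.isAdmissible_minRadius hP hb,
    energyAt Ω D f (fun i : F => (i : Space)) ⟨P₀, hP₀⟩ b - g P₀, sub_nonneg.2 hge, fun φ => ?_⟩
  rw [h.illumination_minRadius hP hPi hb, ← Finset.sum_coe_sort F,
    ← Finset.add_sum_erase _ _ (Finset.mem_univ (⟨P₀, hP₀⟩ : F)),
    ← Finset.add_sum_erase (a := (⟨P₀, hP₀⟩ : F)) _ (fun i : F => φ i * g i) (Finset.mem_univ _),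
    Finset.sum_congr rfl fun i hi => by rw [heq i (Finset.ne_of_mem_erase hi)]]
  ring

/-! ### Passage to the limit -/

lemma isAdmissible_of_tendsto {Ω : Set Sph} {D : Set Space} {a r R : ℝ} (ha : 0 < a) (hr : 0 < r)
    (hDc : IsCompact D) {ρs : ℕ → Sph → ℝ} (h : ∀ n, IsAdmissible Ω D a r R (ρs n)) {ρ : Sph → ℝ}
    (hlim : ∀ x, Tendsto (fun n => ρs n x) atTop (𝓝 (ρ x))) : IsAdmissible Ω D a r R ρ := by
  have hmem : ∀ x, ρ x ∈ Icc r R := fun x =>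
    isClosed_Icc.mem_of_tendsto (hlim x) (Eventually.of_forall fun n => (h n).mem_Icc x)
  refine ⟨LipschitzWith.of_le_add_mul _ fun y z => ?_, hmem, fun x hx => ?_⟩
  · have hg : ∀ y, Tendsto (fun n => radialGauge (ρs n) y) atTop (𝓝 (radialGauge ρ y)) := by
      intro y
      rcases eq_or_ne y 0 with rfl | hy
      · simp [radialGauge_zero]
      · simp only [radialGauge_of_ne _ hy]
        exact tendsto_const_nhds.div (hlim _) (hr.trans_le (hmem _).1).ne'
    exact le_of_tendsto_of_tendsto' (hg y) ((hg z).add_const _)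
      fun n => (h n).lipschitz.le_add_mul y z
  · choose zs hzs hS using fun n => (h n).exists_supports x hx
    obtain ⟨z, hz, φ, hφ, hzφ⟩ := (isCompact_Icc.prod hDc).tendsto_subseq hzs
    exact ⟨z, hz, supports_of_tendsto (ρs := fun n => ρs (φ n)) (xs := fun _ => x)
      (fun y _ => (hlim y).comp hφ.tendsto_atTop) ((hlim x).comp hφ.tendsto_atTop) hzφ
      tendsto_const_nhds (ha.trans_le hz.1.1) fun n => hS (φ n)⟩

/-- Compactness of the set of admissible radial functions. -/
lemma exists_subseq_tendsto_isAdmissible {Ω : Set Sph} {D : Set Space} {a r R : ℝ} (ha : 0 < a)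
    (hr : 0 < r) (hDc : IsCompact D) {ρs : ℕ → Sph → ℝ}
    (h : ∀ n, IsAdmissible Ω D a r R (ρs n)) :
    ∃ ρ, IsAdmissible Ω D a r R ρ ∧ ∃ φ : ℕ → ℕ, StrictMono φ ∧
      ∀ x, Tendsto (fun n => ρs (φ n) x) atTop (𝓝 (ρ x)) := by
  have hlip : ∀ n, LipschitzWith (2 / a).toNNReal fun x : Sph => radialGauge (ρs n) x := fun n => by
    simpa [Function.comp_def] using (h n).lipschitz.comp (LipschitzWith.subtype_val _)
  -- Arzelà–Ascoli is applied to the gauges on the sphere, that is to `1 / ρ`, where the common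
  -- Lipschitz constant is available.
  set U : ℕ → (Sph →ᵇ ℝ) := fun n => BoundedContinuousFunction.mkOfCompact
    ⟨fun x : Sph => radialGauge (ρs n) x, (hlip n).continuous⟩
  have hU : ∀ n x, U n x = 1 / ρs n x := fun n x => radialGauge_sph _ _
  have hcomp : IsCompact (closure (range U)) := by
    refine BoundedContinuousFunction.arzela_ascoli (Icc (1 / R) (1 / r)) isCompact_Icc _ ?_ ?_
    · rintro _ x ⟨n, rfl⟩
      rw [hU]
      have hx := (h n).mem_Icc x
      have hx0 := (h n).pos hr x
      exact ⟨one_div_le_one_div_of_le hx0 hx.2, one_div_le_one_div_of_le hr hx.1⟩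
    · refine (LipschitzWith.uniformEquicontinuous _ (2 / a).toNNReal ?_).equicontinuous
      rintro ⟨_, n, rfl⟩
      exact hlip n
  obtain ⟨V, -, φ, hφ, hV⟩ := hcomp.tendsto_subseq fun n => subset_closure (mem_range_self n)
  have hlim : ∀ x, Tendsto (fun n => ρs (φ n) x) atTop (𝓝 (1 / V x)) := by
    intro x
    have h1 : Tendsto (fun n => U (φ n) x) atTop (𝓝 (V x)) :=
      ((continuous_eval_const (F := Sph →ᵇ ℝ) x).tendsto V).comp hV
    simp only [hU] at h1
    have hVx : V x ≠ 0 := by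
      have hR : 0 < R := ((h 0).pos hr x).trans_le ((h 0).mem_Icc x).2
      have : 1 / R ≤ V x := ge_of_tendsto' h1 fun n =>
        one_div_le_one_div_of_le ((h _).pos hr x) ((h _).mem_Icc x).2
      exact ((by positivity : 0 < 1 / R).trans_le this).ne'
    simpa using h1.inv₀ hVx
  exact ⟨fun x => 1 / V x, isAdmissible_of_tendsto ha hr hDc (fun n => h (φ n)) hlim, φ, hφ, hlim⟩

lemma integral_comp_simpleFunc {η : Measure Space} [IsFiniteMeasure η]
    (s : SimpleFunc Space Space) {F : Finset Space} (hF : ∀ y, s y ∈ F) (φ : Space → ℝ) :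
    ∫ y, φ (s y) ∂η = ∑ P ∈ F, φ P * η.real (s ⁻¹' {P}) := by
  classical
  have h1 : ∀ y, φ (s y) = ∑ P ∈ F, (s ⁻¹' {P}).indicator (fun _ => φ P) y := by
    intro y
    simp [indicator_apply, hF y]
  simp only [h1]
  rw [integral_finsetSum]
  · refine Finset.sum_congr rfl fun P _ => ?_
    rw [integral_indicator_const _ (s.measurableSet_preimage _), smul_eq_mul, mul_comm]
  · intro P _
    exact (integrable_const _).indicator (s.measurableSet_preimage _)

/-- The problem for a general target measure, in terms of test functions. -/
theorem IsSetting.exists_illumination_eq_integral {Ω : Set Sph} {D : Set Space} {f : Sph → ℝ}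
    {a c k : ℝ} (h : IsSetting Ω D f a c k) {η : Measure Space} [IsFiniteMeasure η]
    (hηD : η Dᶜ = 0) (hη : 0 < η.real univ)
    (henergy : η.real univ ≤
      (1 - c) / (1 + c) / (k * a / (1 - c)) ^ 2 * ∫ x in closure Ω, f x ∂surf)
    {P₀ : Space} (hP₀ : P₀ ∈ D) :
    ∃ ρ, IsAdmissible Ω D a (a / (1 + c)) (k * a / (1 - c)) ρ ∧ ∃ e, 0 ≤ e ∧
      ∀ φ : Space →ᵇ ℝ, illumination Ω D f ρ φ = ∫ y, φ y ∂η + e * φ P₀ := by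
  classical
  set s : ℕ → SimpleFunc Space Space := fun n => SimpleFunc.approxOn id measurable_id D P₀ hP₀ n
  set t : ℕ → ℝ := fun n => 1 / ((n : ℝ) + 1)
  have ht : ∀ n, 0 < t n ∧ t n ≤ 1 := fun n =>
    ⟨by positivity, by
      simp only [t]
      rw [div_le_one (by positivity)]
      linarith [(n.cast_nonneg : (0 : ℝ) ≤ n)]⟩
  set F : ℕ → Finset Space := fun n => insert P₀ (s n).range
  -- A fraction `t n` of the total mass is moved to `P₀`. This makes the mass at `P₀` positive, as
  -- the finite problem requires, and preserves the total, so the energy bound still applies.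
  set g : ℕ → Space → ℝ := fun n P =>
    (1 - t n) * η.real (s n ⁻¹' {P}) + if P = P₀ then t n * η.real univ else 0
  have hsum : ∀ n (φ : Space → ℝ), ∑ P ∈ F n, φ P * g n P =
      (1 - t n) * ∫ y, φ (s n y) ∂η + t n * η.real univ * φ P₀ := by
    intro n φ
    rw [integral_comp_simpleFunc (F := F n) (s n)
      (fun y => Finset.mem_insert_of_mem ((s n).mem_range_self y)), Finset.mul_sum]
    simp only [g, mul_add, Finset.sum_add_distrib, mul_ite, mul_zero, Finset.sum_ite_eq', F,
      Finset.mem_insert_self, if_true]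
    congr 1
    · exact Finset.sum_congr rfl fun P _ => by ring
    · ring
  have hex : ∀ n, ∃ ρ, IsAdmissible Ω D a (a / (1 + c)) (k * a / (1 - c)) ρ ∧ ∃ e, 0 ≤ e ∧
      ∀ φ : Space → ℝ, illumination Ω D f ρ φ = ∑ P ∈ F n, φ P * g n P + e * φ P₀ := by
    intro n
    refine h.exists_illumination_eq_sum (F := F n) ?_ (Finset.mem_insert_self _ _)
      (g := g n) (fun P => ?_) ?_ ?_
    · intro P hP
      rw [Finset.mem_coe, Finset.mem_insert, SimpleFunc.mem_range] at hP
      rcases hP with rfl | ⟨y, rfl⟩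
      · exact hP₀
      · exact SimpleFunc.approxOn_mem measurable_id hP₀ n y
    · have h1 : 0 ≤ 1 - t n := by linarith [(ht n).2]
      have h2 := (ht n).1
      simp only [g]
      split_ifs <;> positivity
    · have h1 : 0 ≤ 1 - t n := by linarith [(ht n).2]
      have h2 := (ht n).1
      simp only [g, if_true]
      positivity
    · have h1 := hsum n fun _ => 1
      simp only [one_mul, integral_const, smul_eq_mul, mul_one] at h1
      rw [h1]
      refine le_trans (le_of_eq ?_) henergy
      ring
  choose ρs hρs es hes hill using hex
  obtain ⟨ρ, hρ, ψ, hψ, hlim⟩ :=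
    exists_subseq_tendsto_isAdmissible h.a_pos h.lower_pos h.isCompact hρs
  have hill_lim : ∀ φ : Space →ᵇ ℝ,
      Tendsto (fun n => illumination Ω D f (ρs (ψ n)) φ) atTop (𝓝 (illumination Ω D f ρ φ)) :=
    fun φ => tendsto_illumination h.a_pos h.lower_pos h.isCompact h.inPlane_or_countable
      h.frontier_null h.integrableOn (fun n => hρs (ψ n)) hρ hlim φ.continuous
  have htlim : Tendsto (fun n => t (ψ n)) atTop (𝓝 0) :=
    (tendsto_one_div_add_atTop_nhds_zero_nat (𝕜 := ℝ)).comp hψ.tendsto_atTop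
  have hφlim : ∀ φ : Space →ᵇ ℝ,
      Tendsto (fun n => ∑ P ∈ F (ψ n), φ P * g (ψ n) P) atTop (𝓝 (∫ y, φ y ∂η)) := by
    intro φ
    have h1 : Tendsto (fun n => ∫ y, φ (s n y) ∂η) atTop (𝓝 (∫ y, φ y ∂η)) := by
      refine tendsto_integral_of_dominated_convergence (fun _ => ‖φ‖)
        (fun n => (φ.continuous.measurable.comp (s n).measurable).aestronglyMeasurable)
        (integrable_const _) (fun n => ae_of_all _ fun y => φ.norm_coe_le_norm _) ?_
      have hD : ∀ᵐ y ∂η, y ∈ D := by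
        rw [ae_iff]
        exact hηD
      filter_upwards [hD] with y hy
      exact (φ.continuous.tendsto y).comp
        (SimpleFunc.tendsto_approxOn measurable_id hP₀ (subset_closure hy))
    have h2 := ((htlim.const_sub 1).mul (h1.comp hψ.tendsto_atTop)).add
      ((htlim.mul_const (η.real univ)).mul_const (φ P₀))
    simp only [sub_zero, one_mul, zero_mul, add_zero] at h2
    exact h2.congr fun n => (hsum (ψ n) φ).symm
  -- Testing with the constant 1 expresses the surplus at `P₀` as a difference of two convergent
  -- sequences.
  obtain ⟨e, he⟩ : ∃ e, Tendsto (fun n => es (ψ n)) atTop (𝓝 e) := by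
    refine ⟨_, ((hill_lim (BoundedContinuousFunction.const Space 1)).sub
      (hφlim (BoundedContinuousFunction.const Space 1))).congr fun n => ?_⟩
    rw [hill]
    simp
  refine ⟨ρ, hρ, e, ge_of_tendsto' he fun n => hes _, fun φ => ?_⟩
  refine tendsto_nhds_unique (hill_lim φ) (((hφlim φ).add (he.mul_const (φ P₀))).congr fun n => ?_)
  rw [hill]

/-! ### From test functions to Borel sets -/

section

variable {Ω : Set Sph} {D : Set Space} {f : Sph → ℝ} {a c k r : ℝ} {ρ : Sph → ℝ}

/-- The measure on `D` whose integrals are given by `illumination`. -/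
noncomputable def reflectedMeasure (Ω : Set Sph) (D : Set Space) (f ρ : Sph → ℝ) :
    Measure Space :=
  ((surf.restrict (closure Ω)).withDensity fun x => ENNReal.ofReal (irradiance f ρ x)).map
    fun x => (supportPair Ω D ρ x).2

lemma IsSetting.integrableOn_irradiance (h : IsSetting Ω D f a c k) (hr : 0 < r) {R : ℝ}
    (hρ : IsAdmissible Ω D a r R ρ) : IntegrableOn (irradiance f ρ) (closure Ω) surf :=
  hρ.integrableOn_irradiance h.a_pos hr h.isCompact h.inPlane_or_countable h.frontier_null
    h.integrableOn

lemma IsSetting.aemeasurable_snd_supportPair (h : IsSetting Ω D f a c k) (hr : 0 < r) {R : ℝ}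
    (hρ : IsAdmissible Ω D a r R ρ) :
    AEMeasurable (fun x => (supportPair Ω D ρ x).2) (surf.restrict (closure Ω)) :=
  (hρ.aemeasurable_supportPair h.a_pos hr h.isCompact h.inPlane_or_countable h.frontier_null).snd

lemma IsSetting.integral_reflectedMeasure (h : IsSetting Ω D f a c k) (hr : 0 < r) {R : ℝ}
    (hρ : IsAdmissible Ω D a r R ρ) {φ : Space → ℝ} (hφ : Measurable φ) :
    ∫ y, φ y ∂(reflectedMeasure Ω D f ρ) = illumination Ω D f ρ φ := by
  have hirr := (h.integrableOn_irradiance hr hρ).aestronglyMeasurable.aemeasurable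
  rw [reflectedMeasure, integral_map ((h.aemeasurable_snd_supportPair hr hρ).mono_ac
    (withDensity_absolutelyContinuous _ _)) hφ.aestronglyMeasurable,
    integral_withDensity_eq_integral_toReal_smul₀ hirr.ennreal_ofReal
      (ae_of_all _ fun _ => ENNReal.ofReal_lt_top)]
  refine integral_congr_ae ?_
  filter_upwards [h.ae_isRegularAt hr hρ, h.ae_pos] with x hx hfx
  have h0 : 0 ≤ irradiance f ρ x := by
    rw [hx.irradiance_eq]
    exact mul_nonneg hfx.le (ellDensity_nonneg (h.a_pos.trans_le hx.mem.1.1) _ _)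
  rw [ENNReal.toReal_ofReal h0, smul_eq_mul, mul_comm]

lemma IsSetting.isFiniteMeasure_reflectedMeasure (h : IsSetting Ω D f a c k) (hr : 0 < r) {R : ℝ}
    (hρ : IsAdmissible Ω D a r R ρ) : IsFiniteMeasure (reflectedMeasure Ω D f ρ) := by
  have := isFiniteMeasure_withDensity_ofReal (h.integrableOn_irradiance hr hρ).2
  unfold reflectedMeasure
  infer_instance

lemma IsSetting.trace_ae_eq (h : IsSetting Ω D f a c k) (hr : 0 < r) {R : ℝ}
    (hρ : IsAdmissible Ω D a r R ρ) (E : Set Space) :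
    ∀ᵐ x ∂(surf.restrict (closure Ω)), x ∈ trace Ω D ρ E ↔ (supportPair Ω D ρ x).2 ∈ E := by
  filter_upwards [h.ae_isRegularAt hr hρ] with x hx
  simp [trace, hx.reflectorMap_eq, hx.mem_closure]

lemma IsSetting.nullMeasurableSet_trace (h : IsSetting Ω D f a c k) (hr : 0 < r) {R : ℝ}
    (hρ : IsAdmissible Ω D a r R ρ) {E : Set Space} (hE : MeasurableSet E) :
    NullMeasurableSet (trace Ω D ρ E) surf := by
  have h1 : NullMeasurableSet (trace Ω D ρ E) (surf.restrict (closure Ω)) := by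
    refine ((h.aemeasurable_snd_supportPair hr hρ).nullMeasurableSet_preimage hE).congr ?_
    rw [eventuallyEq_set]
    filter_upwards [h.trace_ae_eq hr hρ E] with x hx
    exact hx.symm
  rw [nullMeasurableSet_restrict isClosed_closure.measurableSet.nullMeasurableSet] at h1
  rwa [inter_eq_left.2 fun x hx => hx.1] at h1

lemma IsSetting.integral_trace (h : IsSetting Ω D f a c k) (hr : 0 < r) {R : ℝ}
    (hρ : IsAdmissible Ω D a r R ρ) {E : Set Space} (hE : MeasurableSet E) :
    ∫ x in trace Ω D ρ E, irradiance f ρ x ∂surf = (reflectedMeasure Ω D f ρ).real E := by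
  have hT := h.nullMeasurableSet_trace hr hρ hE
  have h1 := h.integral_reflectedMeasure hr hρ
    (measurable_const.indicator hE : Measurable (E.indicator fun _ => (1 : ℝ)))
  rw [integral_indicator_const _ hE, smul_eq_mul, mul_one] at h1
  rw [h1, illumination, ← Measure.restrict_restrict_of_subset (s := trace Ω D ρ E)
    (t := closure Ω) (fun x hx => hx.1),
    ← integral_indicator₀ (hT.mono_ac Measure.absolutelyContinuous_restrict)]
  refine integral_congr_ae ?_
  filter_upwards [h.trace_ae_eq hr hρ E] with x hx
  by_cases hxE : x ∈ trace Ω D ρ E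
  · simp [hxE, hx.1 hxE]
  · have hxE' := mt hx.2 hxE
    simp [hxE, hxE']

end

/-! ### The main theorem -/

lemma isSetting_of_le_norm {Ω : Set Sph} {D : Set Space} {f : Sph → ℝ} {δ k M : ℝ}
    (hDc : IsCompact D) (hD : InPlane D ∨ D.Countable) (hΩ : surf (frontier Ω) = 0)
    (hf : IntegrableOn f (closure Ω) surf) (hfpos : ∀ᵐ x ∂(surf.restrict (closure Ω)), 0 < f x)
    (hδ : 0 < δ) (hk : (1 + cConst δ) / (1 - cConst δ) ≤ k) (hM : 0 < M)
    (hDM : ∀ P ∈ D, ‖P‖ ≤ M) : IsSetting Ω D f (δ * M) (cConst δ) k where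
  isCompact := hDc
  inPlane_or_countable := hD
  frontier_null := hΩ
  integrableOn := hf
  ae_pos := hfpos
  a_pos := mul_pos hδ hM
  c_nonneg := (cConst_pos δ).le
  c_lt_one := cConst_lt_one hδ
  norm_eccVec_le := fun P hP _ hd => norm_eccVec_le_cConst hδ (hDM P hP) hM hd
  le_k := hk

end NearField

theorem mainTheorem2
    (D : Set Space) (hDc : IsCompact D) (hD0 : (0 : Space) ∉ D)
    (hD : InPlane D ∨ D.Countable)
    (Ω : Set Sph) (hΩ : surf (frontier Ω) = 0)
    (f : Sph → ℝ) (hf : IntegrableOn f (closure Ω) surf)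
    (hfpos : ∀ᵐ x ∂(surf.restrict (closure Ω)), 0 < f x)
    (η : Measure Space) [η.Regular] (hη : η Dᶜ = 0)
    (δ k : ℝ) (hδ : 0 < δ) (hk : (1 + cConst δ) / (1 - cConst δ) ≤ k)
    (henergy : 1 / energyConst δ (k * δ) (maxDist D) * η.real D ≤ ∫ x in closure Ω, f x ∂surf)
    (P₀ : Space) (hP₀ : P₀ ∈ η.support) :
    ∃ ρ : Sph → ℝ,
      IsInClassA Ω D δ ρ ∧
      (∀ᵐ x ∂(surf.restrict (closure Ω)), HasNormal ρ x) ∧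
      (∀ E ⊆ D, MeasurableSet E →
        NullMeasurableSet (trace Ω D ρ E) surf ∧
        IntegrableOn (irradiance f ρ) (trace Ω D ρ E) surf ∧
        η.real E ≤ ∫ x in trace Ω D ρ E, irradiance f ρ x ∂surf ∧
        (P₀ ∉ E → η.real E = ∫ x in trace Ω D ρ E, irradiance f ρ x ∂surf)) ∧
      (∀ x ∈ closure Ω,
        δ * maxDist D / (1 + cConst δ) ≤ ρ x ∧
        ρ x ≤ k * δ * maxDist D / (1 - cConst δ)) := by
  have hP₀D : P₀ ∈ D := Measure.support_subset_of_isClosed hDc.isClosed hη hP₀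
  have hDM : ∀ P ∈ D, ‖P‖ ≤ maxDist D := fun P hP =>
    le_csSup (hDc.image continuous_norm).bddAbove (mem_image_of_mem _ hP)
  have hM : 0 < maxDist D :=
    (norm_pos_iff.2 (ne_of_mem_of_not_mem hP₀D hD0)).trans_le (hDM P₀ hP₀D)
  have hηD : η univ = η D := by
    refine le_antisymm ?_ (measure_mono (subset_univ D))
    rw [← union_compl_self D]
    exact (measure_union_le _ _).trans (by rw [hη, add_zero])
  have : IsFiniteMeasure η := ⟨hηD ▸ hDc.measure_lt_top⟩
  have hη0 : 0 < η.real univ := by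
    refine ENNReal.toReal_pos ?_ (measure_ne_top _ _)
    rw [Measure.measure_univ_ne_zero]
    rintro rfl
    simp at hP₀
  have h := isSetting_of_le_norm hDc hD hΩ hf hfpos hδ hk hM hDM
  set M := maxDist D
  have hc := h.c_lt_one
  have hc0 := cConst_pos δ
  have hk0 : 0 < k := one_pos.trans_le h.one_le_k
  have hC : (1 - cConst δ) / (1 + cConst δ) / (k * (δ * M) / (1 - cConst δ)) ^ 2 =
      energyConst δ (k * δ) M := by
    have : 1 - cConst δ ≠ 0 := by linarith
    rw [energyConst]
    field_simp
  have hCpos : 0 < energyConst δ (k * δ) M := by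
    have : 0 < 1 - cConst δ := by linarith
    unfold energyConst
    positivity
  have hen : η.real univ ≤ (1 - cConst δ) / (1 + cConst δ) /
      (k * (δ * M) / (1 - cConst δ)) ^ 2 * ∫ x in closure Ω, f x ∂surf := by
    rw [hC, measureReal_def, hηD, ← measureReal_def]
    rwa [one_div, inv_mul_le_iff₀ hCpos] at henergy
  obtain ⟨ρ, hρ, e, he, hill⟩ := h.exists_illumination_eq_integral hη hη0 hen hP₀D
  have hr := h.lower_pos
  -- Bounded continuous functions determine a finite measure, so the identity for test functions
  -- becomes an identity on Borel sets.
  have hmeas : reflectedMeasure Ω D f ρ = η + ENNReal.ofReal e • Measure.dirac P₀ := by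
    have := h.isFiniteMeasure_reflectedMeasure hr hρ
    have : IsFiniteMeasure (ENNReal.ofReal e • Measure.dirac P₀) :=
      Measure.smul_finite _ ENNReal.ofReal_ne_top
    refine ext_of_forall_integral_eq_of_IsFiniteMeasure fun φ => ?_
    rw [h.integral_reflectedMeasure hr hρ φ.continuous.measurable, hill,
      integral_add_measure (φ.integrable _) (φ.integrable _), integral_smul_measure,
      integral_dirac, ENNReal.toReal_ofReal he, smul_eq_mul]
  have hreal : ∀ E, MeasurableSet E → ∫ x in trace Ω D ρ E, irradiance f ρ x ∂surf =
      η.real E + e * E.indicator 1 P₀ := by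
    intro E hE
    rw [h.integral_trace hr hρ hE, hmeas, measureReal_def, Measure.add_apply, Measure.smul_apply,
      Measure.dirac_apply' _ hE, smul_eq_mul]
    by_cases hPE : P₀ ∈ E
    · rw [indicator_of_mem hPE, indicator_of_mem hPE, Pi.one_apply, Pi.one_apply, mul_one, mul_one,
        ENNReal.toReal_add (measure_ne_top _ _) ENNReal.ofReal_ne_top, ENNReal.toReal_ofReal he,
        measureReal_def]
    · rw [indicator_of_notMem hPE, indicator_of_notMem hPE, mul_zero, mul_zero, add_zero, add_zero,
        measureReal_def]
  refine ⟨ρ, ⟨fun x hx => ?_, fun x hx => ?_⟩, ?_, fun E _ hE => ⟨?_, ?_, ?_, fun hPE => ?_⟩,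
    fun x _ => ?_⟩
  · obtain ⟨z, hz, hS⟩ := hρ.exists_supports x hx
    exact ⟨z.2, hz.2, z.1, hS⟩
  · obtain ⟨z, hz, hS⟩ := hρ.exists_supports x hx
    exact ⟨z.2, hz.2, z.1, hz.1.1, hS⟩
  · filter_upwards [h.ae_isRegularAt hr hρ] with x hx
    exact hx.hasNormal
  · exact h.nullMeasurableSet_trace hr hρ hE
  · exact (h.integrableOn_irradiance hr hρ).mono_set fun x hx => hx.1
  · rw [hreal E hE]
    have : 0 ≤ E.indicator (1 : Space → ℝ) P₀ := indicator_nonneg (fun _ _ => zero_le_one) _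
    have := mul_nonneg he this
    linarith
  · rw [hreal E hE, indicator_of_notMem hPE, mul_zero, add_zero]
  · rw [mul_assoc k]
    exact hρ.mem_Icc x
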